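/- Notation. For $a\in\mathbb C$ and $n\in\mathbb N_0$ let $k^a(n)=\frac{a(a+1)\cdots(a+n-1)}{n!}$, $k^a(0)=1$. For $\alpha\ge 0$ and a complex sequence $f=(f(n))_{n\ge 0}$ let $$W^\alpha f(n)=\sum_{j=n}^\infty k^{-\alpha}(j-n)f(j),\qquad n\in\mathbb N_0,$$ whenever these series converge absolutely (so $W^0f=f$, $W^1f(n)=f(n)-f(n+1)$, and $W^m$ is the $m$-th iterate of $W^1$ for $m\in\mathbb N$). For $1\le p\le\infty$, $\tau_p^\alpha$ is the space of complex sequences $f$, vanishing at infinity if $\alpha>0$, for which $W^\alpha f$ is defined and $\|f\|_{\alpha,p}:=\|k^{\alpha+1}W^\alpha f\|_{\ell^p}<\infty$; thus $\tau_p^0=\ell^p$. With $1/\infty=0$, for $t\ge 0$ put $$T_p(t)f(n)=e^{-t/p}\sum_{j=0}^n\binom nj e^{-tj}(1-e^{-t})^{n-j}f(j),\qquad S_p(t)f(n)=e^{-t(1-\frac1p+n)}\sum_{j=n}^\infty\binom jn(1-e^{-t})^{j-n}f(j),$$ and for $\operatorname{Re}\beta>0$ put $$\mathcal C_\beta f(n)=\frac1{k^{\beta+1}(n)}\sum_{j=0}^nk^\beta(n-j)f(j),\qquad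 \mathcal C_\beta^*f(n)=\sum_{j=n}^\infty\frac{1}{k^{\beta+1}(j)}k^\beta(j-n)f(j).$$ Theorem. Let $\alpha\ge 0$ and $\operatorname{Re}\beta>0$. (i) For $1<p\le\infty$, $\mathcal C_\beta$ is a bounded linear operator on $\tau_p^\alpha$, with $$\|\mathcal C_\beta\|\le|\beta|\,\frac{\Gamma(\operatorname{Re}\beta)\,\Gamma(1-\frac1p)}{\Gamma(\operatorname{Re}\beta+1-\frac1p)},$$ and for all $f\in\tau_p^\alpha$ and $n\in\mathbb N_0$ $$\mathcal C_\beta f(n)=\beta\int_0^\infty(1-e^{-t})^{\beta-1}e^{-t(1-\frac1p)}\,T_p(t)f(n)\,dt .$$ (ii) For $1\le p<\infty$, $\mathcal C_\beta^*$ is a bounded linear operator on $\tau_p^\alpha$, with $$\|\mathcal C_\beta^*\|\le|\beta|\,\frac{\Gamma(\operatorname{Re}\beta)\,\Gamma(\frac1p)}{\Gamma(\operatorname{Re}\beta+\frac1p)},$$ and for all $f\in\tau_p^\alpha$ and $n\in\mathbb N_0$ $$\mathcal C_\beta^* f(n)=\beta\int_0^\infty(1-e^{-t})^{\beta-1}e^{-\frac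 tp}\,S_p(t)f(n)\,dt .$$ Here all the integrals converge absolutely, and in (ii) so do the series defining $\mathcal C_\beta^*f(n)$ and $S_p(t)f(n)$, $t\ge0$. -/

import Mathlib

open Filter Topology MeasureTheory
open scoped ENNReal

noncomputable section

namespace CesaroTau

/-- The Cesàro numbers `k^a(n) = a (a + 1) ⋯ (a + n - 1) / n!`, with `k^a(0) = 1`,
for a complex parameter `a`. -/
def cesaroNumber (a : ℂ) (n : ℕ) : ℂ :=
  (∏ i ∈ Finset.range n, (a + (i : ℂ))) / (n.factorial : ℂ)

/-- The Weyl difference `W^α f(n) = ∑_{j ≥ n} k^{-α}(j - n) f(j)` (written with `j` shifted by `n`).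
It is the identity for `α = 0` and the `α`-th iterate of `f(n) - f(n + 1)` for a natural `α`. -/
def weylDiff (α : ℝ) (f : ℕ → ℂ) (n : ℕ) : ℂ :=
  ∑' j : ℕ, cesaroNumber (-(α : ℂ)) j * f (n + j)

/-- `D^α f(n) = k^{α+1}(n) W^α f(n)`. -/
def weightedDiff (α : ℝ) (f : ℕ → ℂ) (n : ℕ) : ℂ :=
  cesaroNumber ((α : ℂ) + 1) n * weylDiff α f n

theorem weightedDiff_add {α : ℝ} {f g : ℕ → ℂ}
    (hf : ∀ n, Summable fun j : ℕ => cesaroNumber (-(α : ℂ)) j * f (n + j))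
    (hg : ∀ n, Summable fun j : ℕ => cesaroNumber (-(α : ℂ)) j * g (n + j)) :
    weightedDiff α (f + g) = weightedDiff α f + weightedDiff α g := by
  funext n
  simp only [weightedDiff, weylDiff, Pi.add_apply, mul_add]
  rw [(hf n).tsum_add (hg n), mul_add]

theorem weightedDiff_smul (α : ℝ) (c : ℂ) (f : ℕ → ℂ) :
    weightedDiff α (c • f) = c • weightedDiff α f := by
  funext n
  simp only [weightedDiff, weylDiff, Pi.smul_apply, smul_eq_mul]
  simp only [mul_left_comm _ c, tsum_mul_left]

/-- The underlying vector space of the Sobolev-Lebesgue sequence space `τ_p^α`: the complex sequences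
(vanishing at infinity when `α > 0`) whose Weyl difference of order `α` is defined and for which
`k^{α+1} W^α f` lies in `ℓ^p`. For `α = 0` this is `ℓ^p`. -/
def tauSubmodule (α : ℝ) (p : ℝ≥0∞) : Submodule ℂ (ℕ → ℂ) where
  carrier := {f | (0 < α → Tendsto f atTop (𝓝 0)) ∧
    (∀ n, Summable fun j : ℕ => cesaroNumber (-(α : ℂ)) j * f (n + j)) ∧
    Memℓp (weightedDiff α f) p}
  zero_mem' := by
    refine ⟨fun _ => tendsto_const_nhds, fun n => by simp, ?_⟩
    have h : weightedDiff α 0 = 0 := by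
      funext n
      simp [weightedDiff, weylDiff]
    rw [h]
    exact zero_memℓp
  add_mem' := by
    rintro f g ⟨hf, hf', hf''⟩ ⟨hg, hg', hg''⟩
    refine ⟨fun h => ?_, fun n => ?_, ?_⟩
    · have h2 := (hf h).add (hg h)
      rw [add_zero] at h2
      exact h2
    · simpa only [Pi.add_apply, mul_add] using (hf' n).add (hg' n)
    · rw [weightedDiff_add hf' hg']
      exact hf''.add hg''
  smul_mem' := by
    rintro c f ⟨hf, hf', hf''⟩
    refine ⟨fun h => ?_, fun n => ?_, ?_⟩
    · have h2 := (hf h).const_smul c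
      rw [smul_zero] at h2
      exact h2
    · simpa only [Pi.smul_apply, smul_eq_mul, mul_left_comm _ c] using (hf' n).mul_left c
    · rw [weightedDiff_smul]
      exact hf''.const_smul c

/-- The space `τ_p^α`, as a type of its own so that it does not carry the topology of
pointwise convergence inherited from `ℕ → ℂ`. -/
def Tau (α : ℝ) (p : ℝ≥0∞) : Type := tauSubmodule α p

namespace Tau

variable {α : ℝ} {p : ℝ≥0∞}

instance : AddCommGroup (Tau α p) := inferInstanceAs (AddCommGroup (tauSubmodule α p))

instance : Module ℂ (Tau α p) := inferInstanceAs (Module ℂ (tauSubmodule α p))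

/-- The sequence underlying an element of `τ_p^α`. -/
def seq (f : Tau α p) : ℕ → ℂ := Subtype.val f

/-- The map `D^α : τ_p^α → ℓ^p`. -/
def toLp (α : ℝ) (p : ℝ≥0∞) : Tau α p →ₗ[ℂ] lp (fun _ : ℕ => ℂ) p where
  toFun f := ⟨weightedDiff α f.seq, f.2.2.2⟩
  map_add' f g := Subtype.ext (weightedDiff_add f.2.2.1 g.2.2.1)
  map_smul' c f := Subtype.ext (weightedDiff_smul α c f.seq)

/-- The norm `‖f‖_{α,p} = ‖k^{α+1} W^α f‖_p`. -/
instance [Fact (1 ≤ p)] : SeminormedAddCommGroup (Tau α p) :=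
  SeminormedAddCommGroup.induced (Tau α p) (lp (fun _ : ℕ => ℂ) p) (toLp α p)

instance [Fact (1 ≤ p)] : NormedSpace ℂ (Tau α p) :=
  NormedSpace.induced ℂ (Tau α p) (lp (fun _ : ℕ => ℂ) p) (toLp α p)

end Tau

/-- The Cesàro operator
`C_β f(n) = (1 / k^{β+1}(n)) ∑_{j=0}^n k^β(n - j) f(j)`. -/
def cesaro (β : ℂ) (f : ℕ → ℂ) (n : ℕ) : ℂ :=
  1 / cesaroNumber (β + 1) n *
    ∑ j ∈ Finset.range (n + 1), cesaroNumber β (n - j) * f j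

/-- The term of index `n + j` of the series defining `C_β^* f(n)`. -/
def dualCesaroTerm (β : ℂ) (f : ℕ → ℂ) (n j : ℕ) : ℂ :=
  1 / cesaroNumber (β + 1) (n + j) * cesaroNumber β j * f (n + j)

/-- The dual Cesàro operator
`C_β^* f(n) = ∑_{j ≥ n} (1 / k^{β+1}(j)) k^β(j - n) f(j)` (written with `j` shifted by `n`). -/
def dualCesaro (β : ℂ) (f : ℕ → ℂ) (n : ℕ) : ℂ :=
  ∑' j : ℕ, dualCesaroTerm β f n j

/-- The real number `1 / p`, which is `0` for `p = ∞`. -/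
def invExp (p : ℝ≥0∞) : ℝ := (p⁻¹).toReal

/-- `T_p(t) f(n) = e^{-t/p} ∑_{j=0}^n (n choose j) e^{-tj} (1 - e^{-t})^{n-j} f(j)`. -/
def semigroupT (p : ℝ≥0∞) (t : ℝ) (f : ℕ → ℂ) (n : ℕ) : ℂ :=
  (Real.exp (-t * invExp p) : ℂ) *
    ∑ j ∈ Finset.range (n + 1),
      ((n.choose j * Real.exp (-t * j) * (1 - Real.exp (-t)) ^ (n - j) : ℝ) : ℂ) * f j

/-- The term of index `n + j` of the series defining `S_p(t) f(n)`. -/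
def semigroupSTerm (t : ℝ) (f : ℕ → ℂ) (n j : ℕ) : ℂ :=
  (((n + j).choose n * (1 - Real.exp (-t)) ^ j : ℝ) : ℂ) * f (n + j)

/-- `S_p(t) f(n) = e^{-t(1 - 1/p + n)} ∑_{j ≥ n} (j choose n) (1 - e^{-t})^{j-n} f(j)`
(written with `j` shifted by `n`). -/
def semigroupS (p : ℝ≥0∞) (t : ℝ) (f : ℕ → ℂ) (n : ℕ) : ℂ :=
  (Real.exp (-t * (1 - invExp p + n)) : ℂ) * ∑' j : ℕ, semigroupSTerm t f n j

/-- `(1 - e^{-t})^{β-1} e^{-ts}`. -/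
def subordKernel (β : ℂ) (s t : ℝ) : ℂ :=
  ((1 - Real.exp (-t) : ℝ) : ℂ) ^ (β - 1) * (Real.exp (-t * s) : ℂ)

end CesaroTau

end

noncomputable section

namespace CesaroTau

/-! ### Cesàro numbers with a real parameter -/

/-! With `r = e^{-t}`, both subordination formulas become averages over `r ∈ (0,1)`, with weight
`(1-r)^{β-1}`, of the binomial kernel `C(n,j) r^j (1-r)^{n-j}` or its transpose. The factors
depending on `p` cancel down to the Jacobian `e^{-t}`. Evaluating a beta integral gives exactly the
coefficients of the two Cesàro operators (`hausCoef_zero_add`).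

For `C_β`, the operator `D^α = k^{α+1} W^α` intertwines binomial averaging on `τ_p^α` with the
explicit nonnegative kernel `binKernel α` (`weightedDiff_binAvg`). Its row sums are at most `1` and
its column sums are `1/r`. Averaging in `r` and using Hölder in `r` to redistribute the powers of
`r` between rows and columns makes both Schur bounds equal to `B(Re β, 1 - 1/p)`
(`seqNorm_betaAvg_le`), whence the norm estimate.

For `C_β^*` with `α = 0`, the same test on the transposed kernel gives `B(Re β, 1/p)`. The case `α >
0` reduces to it: `C_α^*` is the inverse of `D^α` (`weightedDiff_dualCesaro_self`,
`eq_dualCesaro_weightedDiff`), and dual Cesàro operators commute on `ℓ^p` because the transposed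
binomial averages with parameters `r` and `s` compose to the one with parameter `rs`. Hence `D^α
C_β^* = C_β^* D^α` on `τ_p^α`, and the `ℓ^p` bound carries over. -/

/-- The Cesàro numbers with a real parameter. -/
def cesaroReal (a : ℝ) (n : ℕ) : ℝ :=
  (∏ i ∈ Finset.range n, (a + (i : ℝ))) / (n.factorial : ℝ)

theorem cesaroNumber_ofReal (a : ℝ) (n : ℕ) : cesaroNumber (a : ℂ) n = (cesaroReal a n : ℂ) := by
  simp [cesaroNumber, cesaroReal]

theorem cesaroNumber_neg_ofReal (a : ℝ) (n : ℕ) :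
    cesaroNumber (-(a : ℂ)) n = (cesaroReal (-a) n : ℂ) := by
  rw [← cesaroNumber_ofReal]; simp

theorem cesaroNumber_ofReal_add_one (a : ℝ) (n : ℕ) :
    cesaroNumber ((a : ℂ) + 1) n = (cesaroReal (a + 1) n : ℂ) := by
  rw [← cesaroNumber_ofReal]; simp

@[simp] theorem cesaroReal_zero_right (a : ℝ) : cesaroReal a 0 = 1 := by simp [cesaroReal]

theorem cesaroReal_succ (a : ℝ) (n : ℕ) :
    cesaroReal a (n + 1) = cesaroReal a n * (a + n) / (n + 1) := by
  rw [cesaroReal, cesaroReal, Finset.prod_range_succ, Nat.factorial_succ]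
  push_cast
  field_simp

theorem cesaroReal_zero_succ (n : ℕ) : cesaroReal 0 (n + 1) = 0 := by
  induction n with
  | zero => simp [cesaroReal_succ]
  | succ n ih => rw [cesaroReal_succ, ih]; simp

theorem cesaroReal_one (n : ℕ) : cesaroReal 1 n = 1 := by
  induction n with
  | zero => simp
  | succ n ih => rw [cesaroReal_succ, ih]; field_simp; ring

theorem cesaroReal_nonneg {a : ℝ} (ha : 0 ≤ a) (n : ℕ) : 0 ≤ cesaroReal a n :=
  div_nonneg (Finset.prod_nonneg fun i _ => by positivity) (by positivity)

theorem add_one_mul_cesaroReal (a : ℝ) (n : ℕ) :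
    a * cesaroReal (a + 1) n = (a + n) * cesaroReal a n := by
  induction n with
  | zero => simp
  | succ n ih =>
    rw [cesaroReal_succ, cesaroReal_succ]
    push_cast
    linear_combination ((a + 1 + n) / (n + 1)) * ih

theorem cesaroReal_pascal (a : ℝ) (n : ℕ) :
    cesaroReal (a + 1) (n + 1) = cesaroReal (a + 1) n + cesaroReal a (n + 1) := by
  have h := add_one_mul_cesaroReal a n
  have h0 : (n : ℝ) + 1 ≠ 0 := by positivity
  rw [cesaroReal_succ, cesaroReal_succ, div_eq_iff h0, add_mul, div_mul_cancel₀ _ h0]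
  linear_combination h

/-- The rising factorial of length `j + m` splits after its first `j` factors. This is the algebra
behind every kernel identity below. -/
theorem cesaroReal_mul_choose (a : ℝ) (j m : ℕ) :
    cesaroReal a (j + m) * ((j + m).choose j : ℝ) = cesaroReal a j * cesaroReal (a + j) m := by
  have h : ((j + m).choose j : ℝ) * (j.factorial * m.factorial) = (j + m).factorial := by
    have := Nat.add_choose_mul_factorial_mul_factorial j m
    rw [← this, Nat.choose_symm_add]; push_cast; ring
  rw [cesaroReal, cesaroReal, cesaroReal, Finset.prod_range_add, ← h]
  have h1 : ((j + m).choose j : ℝ) ≠ 0 := by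
    exact_mod_cast (Nat.choose_pos (Nat.le_add_right j m)).ne'
  have h2 : (j.factorial : ℝ) ≠ 0 := by positivity
  have h3 : (m.factorial : ℝ) ≠ 0 := by positivity
  push_cast
  simp only [add_assoc]
  field_simp

theorem cesaroReal_natCast_add_one (j m : ℕ) :
    cesaroReal (1 + j) m = ((j + m).choose j : ℝ) := by
  have := cesaroReal_mul_choose 1 j m
  simpa [cesaroReal_one] using this.symm

/-- Gives access to Vandermonde's identity and the binomial series for generalized binomial
coefficients. -/
theorem cesaroReal_eq_choose (a : ℝ) (n : ℕ) :
    cesaroReal a n = (-1) ^ n * Ring.choose (-a) n := by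
  have h : (descPochhammer ℤ n).smeval (-a) = (-1) ^ n * ∏ i ∈ Finset.range n, (a + (i : ℝ)) := by
    induction n with
    | zero => simp
    | succ n ih =>
      rw [descPochhammer_succ_right, Polynomial.smeval_mul, ih, Finset.prod_range_succ]
      simp [Polynomial.smeval_sub, Polynomial.smeval_natCast]
      ring
  rw [Ring.choose_eq_smul, h, cesaroReal, smul_eq_mul]
  have : ((-1 : ℝ) ^ n) * (-1) ^ n = 1 := by rw [← mul_pow]; simp
  field_simp
  linear_combination (-∏ i ∈ Finset.range n, (a + (i : ℝ))) * this

theorem sum_antidiagonal_cesaroReal (a b : ℝ) (n : ℕ) :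
    ∑ ij ∈ Finset.HasAntidiagonal.antidiagonal n, cesaroReal a ij.1 * cesaroReal b ij.2 =
      cesaroReal (a + b) n := by
  rw [cesaroReal_eq_choose, neg_add, Ring.add_choose_eq n (Commute.all _ _), Finset.mul_sum]
  refine Finset.sum_congr rfl fun ij hij => ?_
  rw [cesaroReal_eq_choose, cesaroReal_eq_choose, ← Finset.HasAntidiagonal.mem_antidiagonal.1 hij,
    pow_add]
  ring

theorem hasSum_cesaroReal_mul_pow (a : ℝ) {y : ℝ} (hy : |y| < 1) :
    HasSum (fun n => cesaroReal a n * y ^ n) ((1 - y) ^ (-a)) := by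
  have h := (Real.one_add_rpow_hasFPowerSeriesOnBall_zero (a := -a)).hasSum (y := -y)
    (by simpa [enorm_eq_nnnorm] using! hy)
  rw [zero_add, ← sub_eq_add_neg] at h
  refine h.congr_fun fun n => ?_
  rw [cesaroReal_eq_choose, binomialSeries_apply]
  simp [neg_pow y]
  ring

/-- By Pascal's rule `k^{-a}` is the difference sequence of `k^{1-a}`, whose consecutive ratios `1 -
a/(n+1)` lie in `[0,1]` once `n ≥ a`. From there on the absolute values telescope. -/
theorem summable_abs_cesaroReal_neg {a : ℝ} (ha : 0 ≤ a) :
    Summable fun n => |cesaroReal (-a) n| := by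
  obtain ⟨N, hN⟩ := exists_nat_ge a
  have key : ∀ n : ℕ, N ≤ n →
      |cesaroReal (-a) (n + 1)| = |cesaroReal (-a + 1) n| - |cesaroReal (-a + 1) (n + 1)| := by
    intro n hn
    have hn' : (N : ℝ) ≤ n := by exact_mod_cast hn
    have h1 : cesaroReal (-a) (n + 1) = cesaroReal (-a + 1) n * (-a / (n + 1)) := by
      have h0 : (n : ℝ) + 1 ≠ 0 := by positivity
      rw [cesaroReal_succ]
      field_simp
      linear_combination -add_one_mul_cesaroReal (-a) n
    have h2 : cesaroReal (-a + 1) (n + 1) = cesaroReal (-a + 1) n * (1 - a / (n + 1)) := by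
      rw [cesaroReal_succ]
      field_simp
      ring
    have h3 : a / (n + 1) ≤ 1 := by
      rw [div_le_one (by positivity)]
      linarith
    rw [h1, h2, abs_mul, abs_mul, abs_of_nonneg (sub_nonneg.2 h3), neg_div, abs_neg,
      abs_of_nonneg (by positivity : 0 ≤ a / ((n : ℝ) + 1))]
    ring
  rw [← summable_nat_add_iff (N + 1)]
  refine summable_of_sum_range_le (c := |cesaroReal (-a + 1) N|) (fun _ => abs_nonneg _) fun m => ?_
  have h : ∀ m, ∑ i ∈ Finset.range m, |cesaroReal (-a) (i + (N + 1))| =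
      |cesaroReal (-a + 1) N| - |cesaroReal (-a + 1) (N + m)| := by
    intro m
    induction m with
    | zero => simp
    | succ m ih =>
      rw [Finset.sum_range_succ, ih, ← add_assoc m N 1, key _ (Nat.le_add_left N m), add_comm m N]
      ring_nf
  rw [h]
  linarith [abs_nonneg (cesaroReal (-a + 1) (N + m))]

/-! ### The Schur test on sequence spaces -/

/-- The `ℓ^p` norm of a sequence of extended nonnegative numbers. -/
def seqNorm (p : ℝ≥0∞) (h : ℕ → ℝ≥0∞) : ℝ≥0∞ :=
  if p = ∞ then ⨆ n, h n else (∑' n, h n ^ p.toReal) ^ (1 / p.toReal)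

theorem toReal_pos_of_one_le {p : ℝ≥0∞} (hp : 1 ≤ p) (hp' : p ≠ ∞) : 0 < p.toReal :=
  ENNReal.toReal_pos (by rintro rfl; simp at hp) hp'

theorem seqNorm_mono {p : ℝ≥0∞} {g h : ℕ → ℝ≥0∞} (H : ∀ n, g n ≤ h n) :
    seqNorm p g ≤ seqNorm p h := by
  rw [seqNorm, seqNorm]
  split_ifs
  · exact iSup_mono H
  · gcongr with n
    exact H n

theorem seqNorm_const_mul {p : ℝ≥0∞} (hp : 1 ≤ p) (c : ℝ≥0∞) (h : ℕ → ℝ≥0∞) :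
    seqNorm p (fun n => c * h n) = c * seqNorm p h := by
  rw [seqNorm, seqNorm]
  split_ifs with hp'
  · exact (ENNReal.mul_iSup _ _).symm
  · have h0 := toReal_pos_of_one_le hp hp'
    simp_rw [ENNReal.mul_rpow_of_nonneg _ _ h0.le]
    rw [ENNReal.tsum_mul_left, ENNReal.mul_rpow_of_nonneg _ _ (by positivity), ← ENNReal.rpow_mul,
      mul_one_div_cancel h0.ne', ENNReal.rpow_one]

theorem le_seqNorm {p : ℝ≥0∞} (hp : 1 ≤ p) (h : ℕ → ℝ≥0∞) (n : ℕ) : h n ≤ seqNorm p h := by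
  rw [seqNorm]
  split_ifs with hp'
  · exact le_iSup h n
  · have h0 := toReal_pos_of_one_le hp hp'
    calc h n = (h n ^ p.toReal) ^ (1 / p.toReal) := by
          rw [← ENNReal.rpow_mul, mul_one_div_cancel h0.ne', ENNReal.rpow_one]
      _ ≤ _ := by
          gcongr
          exact ENNReal.le_tsum n

theorem seqNorm_enorm {p : ℝ≥0∞} (hp : 1 ≤ p) (f : lp (fun _ : ℕ => ℂ) p) :
    seqNorm p (fun n => ‖f n‖ₑ) = ENNReal.ofReal ‖f‖ := by
  rw [seqNorm]
  split_ifs with hp'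
  · subst hp'
    apply le_antisymm
    · refine iSup_le fun n => ?_
      rw [← ofReal_norm]
      exact ENNReal.ofReal_le_ofReal (lp.norm_apply_le_norm (by simp) f n)
    · by_cases hS : (⨆ n, ‖f n‖ₑ) = ∞
      · rw [hS]; exact le_top
      · rw [← ENNReal.ofReal_toReal hS]
        refine ENNReal.ofReal_le_ofReal (lp.norm_le_of_forall_le ENNReal.toReal_nonneg fun n => ?_)
        rw [← toReal_enorm]
        exact ENNReal.toReal_mono hS (le_iSup (fun n => ‖f n‖ₑ) n)
  · have h0 := toReal_pos_of_one_le hp hp'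
    rw [lp.norm_eq_tsum_rpow h0, ← ENNReal.ofReal_rpow_of_nonneg
      (tsum_nonneg fun i => by positivity) (by positivity),
      ENNReal.ofReal_tsum_of_nonneg (fun i => by positivity) ((lp.memℓp f).summable h0)]
    congr 2
    funext n
    rw [← ofReal_norm, ENNReal.ofReal_rpow_of_nonneg (norm_nonneg _) h0.le]

theorem memℓp_of_seqNorm_ne_top {p : ℝ≥0∞} (hp : 1 ≤ p) {f : ℕ → ℂ}
    (h : seqNorm p (fun n => ‖f n‖ₑ) ≠ ∞) : Memℓp f p := by
  rw [seqNorm] at h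
  split_ifs at h with hp'
  · subst hp'
    refine memℓp_infty ⟨(⨆ n, ‖f n‖ₑ).toReal, ?_⟩
    rintro _ ⟨n, rfl⟩
    simp only
    rw [← toReal_enorm]
    exact ENNReal.toReal_mono h (le_iSup (fun n => ‖f n‖ₑ) n)
  · have h0 := toReal_pos_of_one_le hp hp'
    refine memℓp_gen ?_
    have h1 : (∑' n, ‖f n‖ₑ ^ p.toReal) ≠ ∞ := by
      intro h2
      rw [h2, ENNReal.top_rpow_of_pos (by positivity)] at h
      exact h rfl
    convert! ENNReal.summable_toReal h1 using 2 with n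
    rw [← ENNReal.toReal_rpow, toReal_enorm]

theorem seqNorm_ne_top {p : ℝ≥0∞} (hp : 1 ≤ p) {f : ℕ → ℂ} (hf : Memℓp f p) :
    seqNorm p (fun n => ‖f n‖ₑ) ≠ ∞ := by
  have := seqNorm_enorm hp (⟨f, hf⟩ : lp (fun _ : ℕ => ℂ) p)
  simp only at this
  rw [this]
  exact ENNReal.ofReal_ne_top

theorem tsum_rpow_mul_rpow_le (f g : ℕ → ℝ≥0∞) {s t : ℝ} (hs : 0 ≤ s) (ht : 0 ≤ t)
    (hst : s + t = 1) :
    ∑' n, f n ^ s * g n ^ t ≤ (∑' n, f n) ^ s * (∑' n, g n) ^ t := by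
  simpa only [lintegral_count] using ENNReal.lintegral_mul_norm_pow_le (μ := Measure.count)
    (measurable_of_countable f).aemeasurable (measurable_of_countable g).aemeasurable hs ht hst

theorem invExp_nonneg (p : ℝ≥0∞) : 0 ≤ invExp p := ENNReal.toReal_nonneg

theorem invExp_le_one {p : ℝ≥0∞} (hp : 1 ≤ p) : invExp p ≤ 1 := by
  rw [invExp, ← ENNReal.toReal_one]
  exact ENNReal.toReal_mono (by simp) (ENNReal.inv_le_one.2 hp)

theorem invExp_lt_one {p : ℝ≥0∞} (hp : 1 < p) : invExp p < 1 := by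
  rw [invExp, ← ENNReal.toReal_one]
  exact (ENNReal.toReal_lt_toReal (by simp [(zero_lt_one.trans hp).ne']) (by simp)).2
    (ENNReal.inv_lt_one.2 hp)

theorem invExp_pos {p : ℝ≥0∞} (hp : 1 ≤ p) (hp' : p ≠ ∞) : 0 < invExp p := by
  rw [invExp, ENNReal.toReal_inv]
  exact inv_pos.2 (toReal_pos_of_one_le hp hp')

/-- Schur's test for a kernel dominated by a geometric mean of a kernel with bounded row sums and a
kernel with bounded column sums. -/
theorem seqNorm_tsum_le {p : ℝ≥0∞} (hp : 1 ≤ p) {e e₁ e₂ : ℕ → ℕ → ℝ≥0∞} {M : ℝ≥0∞}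
    (he : ∀ n j, e n j ≤ e₁ n j ^ (1 - invExp p) * e₂ n j ^ invExp p)
    (h₁ : ∀ n, ∑' j, e₁ n j ≤ M) (h₂ : p ≠ ∞ → ∀ j, ∑' n, e₂ n j ≤ M) (h : ℕ → ℝ≥0∞) :
    seqNorm p (fun n => ∑' j, e n j * h j) ≤ M * seqNorm p h := by
  by_cases hp' : p = ∞
  · subst hp'
    simp only [seqNorm, if_true]
    refine iSup_le fun n => ?_
    calc ∑' j, e n j * h j ≤ ∑' j, e₁ n j * ⨆ n, h n := by
          gcongr with j
          · simpa [invExp] using he n j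
          · exact le_iSup h j
      _ ≤ _ := by
          rw [ENNReal.tsum_mul_right]
          gcongr
          exact h₁ n
  have h0 := toReal_pos_of_one_le hp hp'
  have hθ : invExp p = 1 / p.toReal := by rw [invExp, ENNReal.toReal_inv, one_div]
  have hθ0 := invExp_nonneg p
  have hθ1 := invExp_le_one hp
  have hθp : invExp p * p.toReal = 1 := by rw [hθ]; field_simp
  have hrow : ∀ n, (∑' j, e n j * h j) ^ p.toReal ≤
      M ^ (p.toReal - 1) * ∑' j, e₂ n j * h j ^ p.toReal := by
    intro n
    -- Hölder along row `n`, with all of `h` attached to the factor `e₂`, whose column sums are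
    -- controlled.
    have h3 : ∑' j, e n j * h j ≤
        M ^ (1 - invExp p) * (∑' j, e₂ n j * h j ^ p.toReal) ^ invExp p := by
      calc ∑' j, e n j * h j
          ≤ ∑' j, e₁ n j ^ (1 - invExp p) * (e₂ n j * h j ^ p.toReal) ^ invExp p := by
            refine ENNReal.tsum_le_tsum fun j => ?_
            rw [ENNReal.mul_rpow_of_nonneg _ _ hθ0, ← ENNReal.rpow_mul, mul_comm p.toReal, hθp,
              ENNReal.rpow_one, ← mul_assoc]
            exact mul_le_mul_left (he n j) _
        _ ≤ _ := tsum_rpow_mul_rpow_le _ _ (by linarith) hθ0 (by ring)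
        _ ≤ _ := by
            refine mul_le_mul_left (ENNReal.rpow_le_rpow (h₁ n) (by linarith)) _
    calc (∑' j, e n j * h j) ^ p.toReal
        ≤ (M ^ (1 - invExp p) * (∑' j, e₂ n j * h j ^ p.toReal) ^ invExp p) ^ p.toReal := by
          gcongr
      _ = _ := by
          rw [ENNReal.mul_rpow_of_nonneg _ _ h0.le, ← ENNReal.rpow_mul, ← ENNReal.rpow_mul, hθp,
            ENNReal.rpow_one, sub_mul, hθp, one_mul]
  have hp1 : 0 ≤ p.toReal - 1 := by
    have := ENNReal.toReal_mono hp' hp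
    simp at this
    linarith
  have hsum : ∑' n, (∑' j, e n j * h j) ^ p.toReal ≤ M ^ p.toReal * ∑' j, h j ^ p.toReal := by
    calc ∑' n, (∑' j, e n j * h j) ^ p.toReal
        ≤ ∑' n, M ^ (p.toReal - 1) * ∑' j, e₂ n j * h j ^ p.toReal := by
          gcongr with n
          exact hrow n
      _ = M ^ (p.toReal - 1) * ∑' j, (∑' n, e₂ n j) * h j ^ p.toReal := by
          rw [ENNReal.tsum_mul_left, ENNReal.tsum_comm]
          simp_rw [ENNReal.tsum_mul_right]
      _ ≤ M ^ (p.toReal - 1) * ∑' j, M * h j ^ p.toReal := by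
          gcongr with j
          exact h₂ hp' j
      _ = _ := by
          rw [ENNReal.tsum_mul_left, ← mul_assoc]
          congr 1
          nth_rewrite 2 [← ENNReal.rpow_one M]
          rw [← ENNReal.rpow_add_of_nonneg _ _ hp1 zero_le_one, sub_add_cancel]
  rw [seqNorm, if_neg hp', seqNorm, if_neg hp']
  calc _ ≤ (M ^ p.toReal * ∑' j, h j ^ p.toReal) ^ (1 / p.toReal) := by gcongr
    _ = _ := by
      rw [ENNReal.mul_rpow_of_nonneg _ _ (by positivity), ← ENNReal.rpow_mul,
        mul_one_div_cancel h0.ne', ENNReal.rpow_one]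

theorem summable_of_tsum_enorm_ne_top {ι : Type*} {f : ι → ℂ} (h : ∑' i, ‖f i‖ₑ ≠ ∞) :
    Summable f := by
  refine Summable.of_norm ?_
  simpa using ENNReal.summable_toReal h

/-! ### Binomial kernels -/

/-- The kernel of the operator `h ↦ D^α T(r) (D^α)⁻¹ h`, where `T(r)` is the binomial averaging
operator with parameter `r`. -/
def binKernel (α : ℝ) (n j : ℕ) (r : ℝ) : ℝ :=
  if j ≤ n then cesaroReal (α + 1 + j) (n - j) * r ^ (α + j) * (1 - r) ^ (n - j) else 0

theorem binKernel_add (α : ℝ) (j m : ℕ) (r : ℝ) :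
    binKernel α (j + m) j r = cesaroReal (α + 1 + j) m * r ^ (α + j) * (1 - r) ^ m := by
  simp [binKernel]

theorem binKernel_of_lt (α : ℝ) {n j : ℕ} (h : n < j) (r : ℝ) : binKernel α n j r = 0 := by
  simp [binKernel, h]

theorem binKernel_zero_add (j m : ℕ) (r : ℝ) :
    binKernel 0 (j + m) j r = ((j + m).choose j : ℝ) * r ^ j * (1 - r) ^ m := by
  rw [binKernel_add, zero_add, zero_add, cesaroReal_natCast_add_one, Real.rpow_natCast]

theorem binKernel_nonneg {α : ℝ} (hα : 0 ≤ α) (n j : ℕ) {r : ℝ} (h0 : 0 ≤ r) (h1 : r ≤ 1) :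
    0 ≤ binKernel α n j r := by
  rw [binKernel]
  split_ifs
  · have := cesaroReal_nonneg (a := α + 1 + j) (by positivity) (n - j)
    have := sub_nonneg.2 h1
    positivity
  · rfl

@[fun_prop]
theorem measurable_binKernel (α : ℝ) (n j : ℕ) : Measurable (binKernel α n j) := by
  unfold binKernel
  split_ifs
  · fun_prop
  · fun_prop

/-- Pascal's rule for the Cesàro numbers; for `α = 0` it conditions a binomial variable on its last
trial. -/
theorem binKernel_succ_succ (α : ℝ) (n j : ℕ) {r : ℝ} (hr : 0 < r) :
    binKernel α (n + 1) (j + 1) r = r * binKernel α n j r + (1 - r) * binKernel α n (j + 1) r := by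
  have hpow : r ^ (α + (j + 1 : ℕ)) = r ^ (α + j) * r := by
    rw [Nat.cast_succ, ← add_assoc, Real.rpow_add_one hr.ne']
  rcases lt_trichotomy j n with h | rfl | h
  · obtain ⟨m, rfl⟩ := Nat.exists_eq_add_of_lt h
    rw [show j + m + 1 + 1 = j + 1 + (m + 1) by ring, show j + m + 1 = j + (m + 1) by ring,
      binKernel_add, binKernel_add, show j + (m + 1) = j + 1 + m by ring, binKernel_add, hpow]
    push_cast
    rw [← add_assoc (α + 1), cesaroReal_pascal]
    ring
  · have hd : ∀ i, binKernel α i i r = r ^ (α + i) := fun i => by simp [binKernel]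
    rw [binKernel_of_lt α (Nat.lt_succ_self j), hd, hd, hpow]
    ring
  · rw [binKernel_of_lt α h, binKernel_of_lt α (by lia), binKernel_of_lt α (by lia)]
    simp

/-- In the boundary column Pascal's rule leaves an extra term, which vanishes exactly in the
probabilistic case `α = 0` (for `0 < r < 1` and `α ≥ 0`). -/
theorem binKernel_succ_zero (α : ℝ) (n : ℕ) (r : ℝ) :
    binKernel α (n + 1) 0 r =
      (1 - r) * binKernel α n 0 r + cesaroReal α (n + 1) * r ^ α * (1 - r) ^ (n + 1) := by
  have h1 := binKernel_add α 0 (n + 1) r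
  have h2 := binKernel_add α 0 n r
  simp only [zero_add, Nat.cast_zero, add_zero] at h1 h2
  rw [h1, h2, cesaroReal_pascal]
  ring

/-- The interior recursion preserves row sums, so a row sum just accumulates the boundary terms.
These form a partial sum of the series of `r^{-α}`, which yields the bound `1` when `α ≥ 0`. -/
theorem sum_binKernel (α : ℝ) (n : ℕ) {r : ℝ} (hr : 0 < r) :
    ∑ j ∈ Finset.range (n + 1), binKernel α n j r =
      r ^ α * ∑ i ∈ Finset.range (n + 1), cesaroReal α i * (1 - r) ^ i := by
  induction n with
  | zero => simp [binKernel]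
  | succ n ih =>
    rw [Finset.sum_range_succ', Finset.sum_congr rfl fun j _ => binKernel_succ_succ α n j hr,
      Finset.sum_add_distrib, ← Finset.mul_sum, ← Finset.mul_sum, binKernel_succ_zero,
      Finset.sum_range_succ (fun i => cesaroReal α i * (1 - r) ^ i) (n + 1), mul_add, ← ih]
    have h := Finset.sum_range_succ' (fun j => binKernel α n j r) (n + 1)
    rw [Finset.sum_range_succ, binKernel_of_lt α (Nat.lt_succ_self n), add_zero] at h
    linear_combination (-(1 - r)) * h

theorem sum_binKernel_le_one {α : ℝ} (hα : 0 ≤ α) (n : ℕ) {r : ℝ} (hr : r ∈ Set.Ioo (0 : ℝ) 1) :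
    ∑ j ∈ Finset.range (n + 1), binKernel α n j r ≤ 1 := by
  have hs := hasSum_cesaroReal_mul_pow α (y := 1 - r)
    (by rw [abs_of_nonneg] <;> linarith [hr.1, hr.2])
  rw [sub_sub_cancel] at hs
  have h1 : (0 : ℝ) ≤ 1 - r := by linarith [hr.2]
  have := sum_le_hasSum (Finset.range (n + 1))
    (fun i _ => mul_nonneg (cesaroReal_nonneg hα i) (pow_nonneg h1 i)) hs
  rw [sum_binKernel α n hr.1]
  calc _ ≤ r ^ α * r ^ (-α) := mul_le_mul_of_nonneg_left this (Real.rpow_nonneg hr.1.le _)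
    _ = 1 := by rw [← Real.rpow_add hr.1]; simp

theorem sum_binKernel_zero (n : ℕ) {r : ℝ} (hr : 0 < r) :
    ∑ j ∈ Finset.range (n + 1), binKernel 0 n j r = 1 := by
  rw [sum_binKernel 0 n hr, Finset.sum_range_succ']
  simp [cesaroReal_zero_succ]

/-- The binomial series gives `r^{α+j} · r^{-(α+1+j)}`, so the sum depends on neither `α` nor `j`.
-/
theorem hasSum_binKernel_column (α : ℝ) (j : ℕ) {r : ℝ} (hr : r ∈ Set.Ioo (0 : ℝ) 1) :
    HasSum (fun m => binKernel α (j + m) j r) r⁻¹ := by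
  have hs := (hasSum_cesaroReal_mul_pow (α + 1 + j) (y := 1 - r)
    (by rw [abs_of_nonneg] <;> linarith [hr.1, hr.2])).mul_left (r ^ (α + j))
  rw [sub_sub_cancel, ← Real.rpow_add hr.1,
    show α + j + -(α + 1 + j) = -1 by ring, Real.rpow_neg_one] at hs
  refine hs.congr_fun fun m => ?_
  rw [binKernel_add]
  ring

theorem tsum_ofReal_binKernel_row_le {α : ℝ} (hα : 0 ≤ α) (n : ℕ) {r : ℝ}
    (hr : r ∈ Set.Ioo (0 : ℝ) 1) : ∑' j, ENNReal.ofReal (binKernel α n j r) ≤ 1 := by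
  rw [tsum_eq_sum (s := Finset.range (n + 1)) fun j hj => by
    rw [binKernel_of_lt α (by simpa [Nat.lt_succ_iff] using hj), ENNReal.ofReal_zero],
    ← ENNReal.ofReal_sum_of_nonneg fun j _ => binKernel_nonneg hα n j hr.1.le hr.2.le]
  exact ENNReal.ofReal_le_one.2 (sum_binKernel_le_one hα n hr)

theorem tsum_nat_of_eq_zero_of_lt {M : Type*} [AddCommMonoid M] [TopologicalSpace M] {f : ℕ → M}
    {j : ℕ} (h : ∀ n < j, f n = 0) :
    ∑' n, f n = ∑' m, f (j + m) := by
  refine ((add_right_injective j).tsum_eq fun n hn => ?_).symm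
  by_contra h'
  refine hn (h n (not_le.1 fun h2 => h' ?_))
  exact ⟨n - j, by simp [h2]⟩

theorem tsum_ofReal_binKernel_column {α : ℝ} (hα : 0 ≤ α) (j : ℕ) {r : ℝ}
    (hr : r ∈ Set.Ioo (0 : ℝ) 1) :
    ∑' n, ENNReal.ofReal (binKernel α n j r) = ENNReal.ofReal r⁻¹ := by
  have hs := hasSum_binKernel_column α j hr
  rw [tsum_nat_of_eq_zero_of_lt (j := j) fun n hn => by
      rw [binKernel_of_lt α hn, ENNReal.ofReal_zero],
    ← ENNReal.ofReal_tsum_of_nonneg (fun m => binKernel_nonneg hα _ j hr.1.le hr.2.le) hs.summable,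
    hs.tsum_eq]

/-! ### Beta averages of the binomial kernels -/

theorem lintegral_beta {b s : ℝ} (hb : 0 < b) (hs : 0 < s) :
    ∫⁻ r in Set.Ioo (0 : ℝ) 1, ENNReal.ofReal ((1 - r) ^ (b - 1) * r ^ (s - 1)) =
      ENNReal.ofReal (Real.Gamma b * Real.Gamma s / Real.Gamma (b + s)) := by
  have h := ProbabilityTheory.lintegral_betaPDF_eq_one hs hb
  have hpos := ProbabilityTheory.beta_pos hs hb
  rw [ProbabilityTheory.lintegral_betaPDF] at h
  have h2 : Real.Gamma b * Real.Gamma s / Real.Gamma (b + s) = ProbabilityTheory.beta s b := by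
    rw [ProbabilityTheory.beta, mul_comm, add_comm]
  have h3 : ∀ r : ℝ, ENNReal.ofReal ((1 - r) ^ (b - 1) * r ^ (s - 1)) =
      ENNReal.ofReal (ProbabilityTheory.beta s b) *
        ENNReal.ofReal (1 / ProbabilityTheory.beta s b * r ^ (s - 1) * (1 - r) ^ (b - 1)) := by
    intro r
    rw [← ENNReal.ofReal_mul hpos.le]
    congr 1
    field_simp
  simp_rw [h3]
  rw [lintegral_const_mul _ (by fun_prop), h, mul_one, h2]

/-- The average of a binomial kernel against the weight `(1 - r)^{b-1} r^{s-1}` on `(0, 1)`. -/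
def betaAvg (α b s : ℝ) (n j : ℕ) : ℝ≥0∞ :=
  ∫⁻ r in Set.Ioo (0 : ℝ) 1,
    ENNReal.ofReal ((1 - r) ^ (b - 1) * r ^ (s - 1)) * ENNReal.ofReal (binKernel α n j r)

theorem tsum_betaAvg_row_le {α b s : ℝ} (hα : 0 ≤ α) (hb : 0 < b) (hs : 0 < s) (n : ℕ) :
    ∑' j, betaAvg α b s n j ≤
      ENNReal.ofReal (Real.Gamma b * Real.Gamma s / Real.Gamma (b + s)) := by
  simp_rw [betaAvg]
  rw [← lintegral_tsum (fun j => by fun_prop), ← lintegral_beta hb hs]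
  refine setLIntegral_mono' measurableSet_Ioo fun r hr => ?_
  rw [ENNReal.tsum_mul_left]
  exact mul_le_of_le_one_right' (tsum_ofReal_binKernel_row_le hα n hr)

/-- The exponent `s + 1` absorbs the column sum `1/r`, so that columns and rows share one constant.
-/
theorem tsum_betaAvg_column_le {α b s : ℝ} (hα : 0 ≤ α) (hb : 0 < b) (hs : 0 < s) (j : ℕ) :
    ∑' n, betaAvg α b (s + 1) n j ≤
      ENNReal.ofReal (Real.Gamma b * Real.Gamma s / Real.Gamma (b + s)) := by
  simp_rw [betaAvg]
  rw [← lintegral_tsum (fun j => by fun_prop), ← lintegral_beta hb hs]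
  refine setLIntegral_mono' measurableSet_Ioo fun r hr => ?_
  have h1 : 0 ≤ 1 - r := by linarith [hr.2]
  have h0 := hr.1
  rw [ENNReal.tsum_mul_left, tsum_ofReal_binKernel_column hα j hr,
    ← ENNReal.ofReal_mul (by positivity), add_sub_cancel_right, mul_assoc]
  refine ENNReal.ofReal_le_ofReal (le_of_eq ?_)
  rw [← Real.rpow_neg_one r, ← Real.rpow_add h0, ← sub_eq_add_neg]

/-- Hölder in `r`: the three averages differ only in the power of `r`, and `huv` says that the
powers `u - 1` and `v - 1` average out to `0`. -/
theorem betaAvg_le_mul {α b u v θ : ℝ} (h0 : 0 ≤ θ) (h1 : θ ≤ 1)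
    (huv : (1 - θ) * u + θ * v = 1) (n j : ℕ) :
    betaAvg α b 1 n j ≤ betaAvg α b u n j ^ (1 - θ) * betaAvg α b v n j ^ θ := by
  refine le_trans (le_of_eq ?_) (ENNReal.lintegral_mul_norm_pow_le
    (by fun_prop) (by fun_prop) (by linarith) h0 (by ring))
  refine setLIntegral_congr_fun measurableSet_Ioo fun r hr => ?_
  have hr1 : 0 < 1 - r := by linarith [hr.2]
  have hr0 := hr.1
  have h1θ : 0 ≤ 1 - θ := by linarith
  rw [ENNReal.mul_rpow_of_nonneg _ _ h1θ, ENNReal.mul_rpow_of_nonneg _ _ h0, mul_mul_mul_comm,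
    ← ENNReal.rpow_add_of_nonneg _ _ h1θ h0, sub_add_cancel, ENNReal.rpow_one,
    ENNReal.ofReal_rpow_of_pos (by positivity), ENNReal.ofReal_rpow_of_pos (by positivity),
    Real.mul_rpow (by positivity) (by positivity), Real.mul_rpow (by positivity) (by positivity)]
  congr 1
  rw [← ENNReal.ofReal_mul (by positivity), mul_mul_mul_comm, ← Real.rpow_mul hr1.le,
    ← Real.rpow_mul hr1.le, ← Real.rpow_mul hr0.le, ← Real.rpow_mul hr0.le, ← Real.rpow_add hr1,
    ← Real.rpow_add hr0]
  congr 3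
  · ring
  · linear_combination -huv

theorem betaAvg_ne_top {α b s : ℝ} (hα : 0 ≤ α) (hb : 0 < b) (hs : 0 < s) (n j : ℕ) :
    betaAvg α b s n j ≠ ∞ :=
  ((ENNReal.le_tsum j).trans (tsum_betaAvg_row_le hα hb hs n)).trans_lt ENNReal.ofReal_lt_top |>.ne

/-! ### Hausdorff coefficients -/

/-- The weight `(1 - r)^{β-1}`. -/
def betaWeight (β : ℂ) (r : ℝ) : ℂ := ((1 - r : ℝ) : ℂ) ^ (β - 1)

@[fun_prop]
theorem measurable_betaWeight (β : ℂ) : Measurable (betaWeight β) := by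
  unfold betaWeight
  fun_prop

theorem enorm_betaWeight (β : ℂ) {r : ℝ} (hr : r < 1) :
    ‖betaWeight β r‖ₑ = ENNReal.ofReal ((1 - r) ^ (β.re - 1) * r ^ ((1 : ℝ) - 1)) := by
  rw [← ofReal_norm, betaWeight, Complex.norm_cpow_eq_rpow_re_of_pos (sub_pos.2 hr)]
  simp

theorem lintegral_enorm_betaWeight_mul_binKernel {α : ℝ} (hα : 0 ≤ α) (β : ℂ) (n j : ℕ) :
    ∫⁻ r in Set.Ioo (0 : ℝ) 1, ‖betaWeight β r * (binKernel α n j r : ℂ)‖ₑ =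
      betaAvg α β.re 1 n j := by
  refine setLIntegral_congr_fun measurableSet_Ioo fun r hr => ?_
  rw [enorm_mul, enorm_betaWeight β hr.2, ← ofReal_norm (binKernel α n j r : ℂ), Complex.norm_real,
    Real.norm_of_nonneg (binKernel_nonneg hα n j hr.1.le hr.2.le)]

theorem integrableOn_betaWeight_mul_binKernel {α : ℝ} (hα : 0 ≤ α) {β : ℂ} (hβ : 0 < β.re)
    (n j : ℕ) :
    IntegrableOn (fun r => betaWeight β r * (binKernel α n j r : ℂ)) (Set.Ioo (0 : ℝ) 1) := by
  refine ⟨by fun_prop, ?_⟩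
  rw [hasFiniteIntegral_iff_enorm, lintegral_enorm_betaWeight_mul_binKernel hα]
  exact (betaAvg_ne_top hα hβ one_pos n j).lt_top

/-- The coefficients `β ∫_0^1 (1 - r)^{β-1} κ(r) dr` obtained by averaging a binomial kernel `κ`. -/
def hausCoef (β : ℂ) (α : ℝ) (n j : ℕ) : ℂ :=
  β * ∫ r in Set.Ioo (0 : ℝ) 1, betaWeight β r * (binKernel α n j r : ℂ)

theorem hausCoef_of_lt (β : ℂ) (α : ℝ) {n j : ℕ} (h : n < j) : hausCoef β α n j = 0 := by
  simp [hausCoef, binKernel_of_lt α h]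

theorem enorm_hausCoef_le {α : ℝ} (hα : 0 ≤ α) (β : ℂ) (n j : ℕ) :
    ‖hausCoef β α n j‖ₑ ≤ ‖β‖ₑ * betaAvg α β.re 1 n j := by
  rw [hausCoef, enorm_mul]
  gcongr
  exact (enorm_integral_le_lintegral_enorm _).trans_eq
    (lintegral_enorm_betaWeight_mul_binKernel hα β n j)

theorem factorial_mul_cesaroNumber (a : ℂ) (n : ℕ) :
    (n.factorial : ℂ) * cesaroNumber a n = ∏ i ∈ Finset.range n, (a + (i : ℂ)) := by
  rw [cesaroNumber]
  have : (n.factorial : ℂ) ≠ 0 := by exact_mod_cast n.factorial_ne_zero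
  field_simp

theorem cesaroNumber_ne_zero {a : ℂ} (ha : 0 < a.re) (n : ℕ) : cesaroNumber a n ≠ 0 := by
  refine div_ne_zero (Finset.prod_ne_zero_iff.2 fun i _ h => ?_)
    (by exact_mod_cast n.factorial_ne_zero)
  have := congrArg Complex.re h
  simp at this
  have h2 : (0 : ℝ) ≤ i := by positivity
  linarith

/-- The integral is `C(j+m, j) B(β + m, j + 1)`, and a beta function with an integer argument is a
quotient of products. -/
theorem hausCoef_zero_add {β : ℂ} (hβ : 0 < β.re) (j m : ℕ) :
    hausCoef β 0 (j + m) j = 1 / cesaroNumber (β + 1) (j + m) * cesaroNumber β m := by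
  have hβm : 0 < (β + m).re := by simp; positivity
  have hint : ∫ r in Set.Ioo (0 : ℝ) 1, betaWeight β r * (binKernel 0 (j + m) j r : ℂ) =
      ((j + m).choose j : ℂ) * Complex.betaIntegral (β + m) (j + 1) := by
    rw [← Complex.betaIntegral_symm, Complex.betaIntegral,
      intervalIntegral.integral_of_le zero_le_one, integral_Ioc_eq_integral_Ioo,
      ← integral_const_mul]
    refine setIntegral_congr_fun measurableSet_Ioo fun r hr => ?_
    have h1 : ((1 - r : ℝ) : ℂ) ≠ 0 := by exact_mod_cast (sub_pos.2 hr.2).ne'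
    rw [binKernel_zero_add, betaWeight, add_sub_cancel_right, Complex.cpow_natCast,
      show (1 : ℂ) - r = ((1 - r : ℝ) : ℂ) by push_cast; rfl,
      show β + m - 1 = β - 1 + m by ring, Complex.cpow_add _ _ h1, Complex.cpow_natCast]
    push_cast
    ring
  have hβ0 : β ≠ 0 := by rintro rfl; simp at hβ
  have hc := cesaroNumber_ne_zero (a := β + 1) (by simp; linarith) (j + m)
  have e1 := factorial_mul_cesaroNumber (β + 1) (j + m)
  have e2 := factorial_mul_cesaroNumber β m
  -- Both sides are `β (β+1) ⋯ (β+j+m)`, cut in two different places.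
  have e3 : β * ∏ i ∈ Finset.range (j + m), (β + 1 + (i : ℂ)) =
      (∏ i ∈ Finset.range m, (β + (i : ℂ))) * ∏ i ∈ Finset.range (j + 1), (β + m + (i : ℂ)) := by
    have := Finset.prod_range_add (fun i : ℕ => β + (i : ℂ)) m (j + 1)
    rw [show m + (j + 1) = j + m + 1 by ring, Finset.prod_range_succ'] at this
    push_cast at this
    simp only [add_assoc, add_zero, add_comm (1 : ℂ)] at this ⊢
    rw [← this]
    ring
  have e4 : ((j + m).choose j : ℂ) * (j.factorial * m.factorial) = (j + m).factorial := by
    have := Nat.add_choose_mul_factorial_mul_factorial j m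
    rw [← this, Nat.choose_symm_add]; push_cast; ring
  have hm : (m.factorial : ℂ) ≠ 0 := by exact_mod_cast m.factorial_ne_zero
  have hP : ∏ i ∈ Finset.range (j + 1), (β + m + (i : ℂ)) ≠ 0 := by
    refine Finset.prod_ne_zero_iff.2 fun i _ h => ?_
    have h3 := congrArg Complex.re h
    simp at h3
    have h2 : (0 : ℝ) ≤ i := by positivity
    have h4 : (0 : ℝ) ≤ m := by positivity
    linarith
  rw [hausCoef, hint, Complex.betaIntegral_eval_nat_add_one_right hβm, one_div_mul_eq_div,
    eq_div_iff hc, mul_div_assoc', mul_div_assoc', div_mul_eq_mul_div, div_eq_iff hP]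
  apply mul_left_cancel₀ hm
  rw [← e1, ← e2] at e3
  linear_combination β * cesaroNumber (β + 1) (j + m) * e4 + e3

/-! ### Weyl differences of bounded sequences -/

theorem summable_of_tsum_tsum_enorm_ne_top {ι κ : Type*} {f : ι → κ → ℂ}
    (h : ∑' i, ∑' k, ‖f i k‖ₑ ≠ ∞) : Summable (Function.uncurry f) := by
  refine summable_of_tsum_enorm_ne_top ?_
  rw [ENNReal.tsum_prod']
  exact h

/-- Fubini along antidiagonals: `f` sees only `i + l`, so the coefficients combine by convolution.
-/
theorem tsum_mul_tsum_shift {u v f : ℕ → ℂ} (n : ℕ)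
    (h : ∑' i, ∑' l, ‖u i * (v l * f (n + i + l))‖ₑ ≠ ∞) :
    ∑' i, u i * ∑' l, v l * f (n + i + l) =
      ∑' N, (∑ ij ∈ Finset.HasAntidiagonal.antidiagonal N, u ij.1 * v ij.2) * f (n + N) := by
  have hs := summable_of_tsum_tsum_enorm_ne_top h
  have hs' := Finset.HasAntidiagonal.sigmaAntidiagonalEquivProd.summable_iff.2 hs
  simp_rw [← tsum_mul_left]
  rw [← hs.tsum_prod (f := fun x : ℕ × ℕ => u x.1 * (v x.2 * f (n + x.1 + x.2))),
    ← Finset.HasAntidiagonal.sigmaAntidiagonalEquivProd.tsum_eq]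
  refine (hs'.tsum_sigma' fun _ => (hasSum_fintype _).summable).trans ?_
  refine tsum_congr fun N => ?_
  rw [tsum_fintype, Finset.sum_mul,
    ← Finset.sum_coe_sort (Finset.HasAntidiagonal.antidiagonal N)
      fun ij => u ij.1 * v ij.2 * f (n + N)]
  refine Finset.sum_congr rfl fun x _ => ?_
  have hx : n + x.1.1 + x.1.2 = n + N := by
    rw [add_assoc, Finset.HasAntidiagonal.mem_antidiagonal.1 x.2]
  simp only [Function.comp_apply, Function.uncurry,
    Finset.HasAntidiagonal.sigmaAntidiagonalEquivProd_apply]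
  rw [hx, mul_assoc]

theorem weylDiff_eq (α : ℝ) (f : ℕ → ℂ) (n : ℕ) :
    weylDiff α f n = ∑' j : ℕ, (cesaroReal (-α) j : ℂ) * f (n + j) := by
  simp_rw [weylDiff, cesaroNumber_neg_ofReal]

theorem tsum_enorm_cesaroReal_neg_ne_top {α : ℝ} (hα : 0 ≤ α) :
    ∑' j, ‖(cesaroReal (-α) j : ℂ)‖ₑ ≠ ∞ := by
  have := (summable_abs_cesaroReal_neg hα).tsum_ofReal_ne_top
  convert! this using 3 with j
  rw [← ofReal_norm, Complex.norm_real, Real.norm_eq_abs]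

theorem summable_weylDiff {α : ℝ} (hα : 0 ≤ α) {f : ℕ → ℂ} {C : ℝ} (hf : ∀ n, ‖f n‖ ≤ C) (n : ℕ) :
    Summable fun j : ℕ => cesaroNumber (-(α : ℂ)) j * f (n + j) := by
  refine Summable.of_norm_bounded ((summable_abs_cesaroReal_neg hα).mul_right C) fun j => ?_
  rw [cesaroNumber_neg_ofReal, norm_mul, Complex.norm_real, Real.norm_eq_abs]
  exact mul_le_mul_of_nonneg_left (hf _) (abs_nonneg _)

theorem weylDiff_zero (f : ℕ → ℂ) : weylDiff 0 f = f := by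
  funext n
  rw [weylDiff_eq, tsum_eq_single 0 fun j hj => ?_]
  · simp
  · obtain ⟨i, rfl⟩ := Nat.exists_eq_succ_of_ne_zero hj
    simp [cesaroReal_zero_succ]

theorem weightedDiff_zero (f : ℕ → ℂ) : weightedDiff 0 f = f := by
  funext n
  rw [weightedDiff, weylDiff_zero, cesaroNumber_ofReal_add_one, zero_add, cesaroReal_one]
  simp

theorem weylDiff_one (f : ℕ → ℂ) (n : ℕ) : weylDiff 1 f n = f n - f (n + 1) := by
  rw [weylDiff_eq, tsum_eq_sum (s := Finset.range 2) fun j hj => ?_]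
  · simp [Finset.sum_range_succ, cesaroReal_succ]
    ring
  · obtain ⟨i, rfl⟩ := Nat.exists_eq_add_of_le (not_lt.1 fun h => hj (Finset.mem_range.2 h))
    have : cesaroReal (-1) (2 + i) = 0 := by
      rw [cesaroReal, Finset.prod_eq_zero (i := 1) (Finset.mem_range.2 (by lia)) (by simp),
        zero_div]
    simp [this]

theorem tsum_weylDiff_conv_ne_top {α : ℝ} (hα : 0 ≤ α) {v g : ℕ → ℂ} {C : ℝ≥0∞} (hC : C ≠ ∞)
    (h : ∀ n, ∑' l, ‖v l * g (n + l)‖ₑ ≤ C) (n : ℕ) :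
    ∑' i, ∑' l, ‖(cesaroReal (-α) i : ℂ) * (v l * g (n + i + l))‖ₑ ≠ ∞ := by
  refine ne_top_of_le_ne_top (ENNReal.mul_ne_top (tsum_enorm_cesaroReal_neg_ne_top hα) hC) ?_
  rw [← ENNReal.tsum_mul_right]
  refine ENNReal.tsum_le_tsum fun i => ?_
  simp_rw [enorm_mul (cesaroReal (-α) i : ℂ)]
  rw [ENNReal.tsum_mul_left]
  exact mul_le_mul_right (h _) _

/-- Vandermonde gives `k^{-a} * k^{-b} = k^{-(a+b)}`; boundedness of `f` and summability of both
factors justify the rearrangement. -/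
theorem weylDiff_weylDiff {a b : ℝ} (ha : 0 ≤ a) (hb : 0 ≤ b) {f : ℕ → ℂ} {C : ℝ}
    (hf : ∀ n, ‖f n‖ ≤ C) : weylDiff a (weylDiff b f) = weylDiff (a + b) f := by
  funext n
  rw [weylDiff_eq]
  simp_rw [weylDiff_eq b]
  rw [tsum_mul_tsum_shift n (tsum_weylDiff_conv_ne_top ha
    (C := (∑' l, ‖(cesaroReal (-b) l : ℂ)‖ₑ) * ENNReal.ofReal C)
    (ENNReal.mul_ne_top (tsum_enorm_cesaroReal_neg_ne_top hb) ENNReal.ofReal_ne_top)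
    (fun n => ?_) n), weylDiff_eq]
  · refine tsum_congr fun N => ?_
    rw [neg_add, ← sum_antidiagonal_cesaroReal]
    push_cast
    rfl
  · rw [← ENNReal.tsum_mul_right]
    refine ENNReal.tsum_le_tsum fun l => ?_
    rw [enorm_mul, ← ofReal_norm (f _)]
    exact mul_le_mul_right (ENNReal.ofReal_le_ofReal (hf _)) _

theorem exists_norm_le_of_tendsto {f : ℕ → ℂ} {a : ℂ} (hf : Tendsto f atTop (𝓝 a)) :
    ∃ C, ∀ n, ‖f n‖ ≤ C := by
  obtain ⟨C, hC⟩ := hf.norm.bddAbove_range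
  exact ⟨C, fun n => hC ⟨n, rfl⟩⟩

/-- By induction the first difference vanishes, so the sequence is constant, and its limit forces it
to be zero. -/
theorem eq_zero_of_weylDiff_natCast_eq_zero (m : ℕ) {u : ℕ → ℂ} (hu : Tendsto u atTop (𝓝 0))
    (h : weylDiff m u = 0) : u = 0 := by
  induction m generalizing u with
  | zero => simpa [weylDiff_zero] using h
  | succ m ih =>
    obtain ⟨C, hC⟩ := exists_norm_le_of_tendsto hu
    have h1 : weylDiff 1 u = 0 := by
      refine ih ?_ ?_
      · have := hu.sub (hu.comp (tendsto_add_atTop_nat 1))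
        rw [sub_zero] at this
        exact this.congr fun n => (weylDiff_one u n).symm
      · rw [weylDiff_weylDiff m.cast_nonneg zero_le_one hC]
        exact_mod_cast h
    have h2 : ∀ n, u n = u 0 := by
      intro n
      induction n with
      | zero => rfl
      | succ n ihn =>
        have := congrFun h1 n
        rw [weylDiff_one, Pi.zero_apply, sub_eq_zero] at this
        rw [← this, ihn]
    have h3 : u 0 = 0 := by
      refine tendsto_nhds_unique (tendsto_const_nhds (x := u 0) (f := atTop)) (hu.congr h2)
    funext n
    rw [h2, h3]
    rfl

/-- Applying `W^{m-α}` with an integer `m ≥ α` reduces to integer order. -/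
theorem eq_zero_of_weylDiff_eq_zero {α : ℝ} (hα : 0 ≤ α) {u : ℕ → ℂ}
    (hu : Tendsto u atTop (𝓝 0)) (h : weylDiff α u = 0) : u = 0 := by
  obtain ⟨m, hm⟩ := exists_nat_ge α
  obtain ⟨C, hC⟩ := exists_norm_le_of_tendsto hu
  refine eq_zero_of_weylDiff_natCast_eq_zero m hu ?_
  rw [← sub_add_cancel (m : ℝ) α, ← weylDiff_weylDiff (sub_nonneg.2 hm) hα hC, h]
  funext n
  simp [weylDiff]

/-! ### Binomial averages -/

/-- The binomial average `∑_{j ≤ n} (n choose j) r^j (1 - r)^{n-j} f(j)`. -/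
def binAvg (r : ℝ) (f : ℕ → ℂ) (n : ℕ) : ℂ :=
  ∑ j ∈ Finset.range (n + 1), (binKernel 0 n j r : ℂ) * f j

theorem binAvg_succ {r : ℝ} (hr : 0 < r) (f : ℕ → ℂ) (n : ℕ) :
    binAvg r f (n + 1) = (1 - r) * binAvg r f n + r * binAvg r (fun k => f (k + 1)) n := by
  simp only [binAvg]
  rw [Finset.sum_range_succ', binKernel_succ_zero, cesaroReal_zero_succ]
  simp_rw [binKernel_succ_succ 0 n _ hr]
  have h := Finset.sum_range_succ' (fun j => (binKernel 0 n j r : ℂ) * f j) (n + 1)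
  rw [Finset.sum_range_succ, binKernel_of_lt 0 (Nat.lt_succ_self n)] at h
  push_cast at h ⊢
  simp only [add_mul, Finset.sum_add_distrib, mul_assoc, ← Finset.mul_sum] at h ⊢
  linear_combination (-(1 - (r : ℂ))) * h

/-- A binomial variable with `n + m` trials is the sum of independent ones with `n` and `m` trials.
-/
theorem binAvg_add {r : ℝ} (hr : 0 < r) (f : ℕ → ℂ) (n m : ℕ) :
    binAvg r f (n + m) = binAvg r (fun i => binAvg r (fun k => f (k + i)) n) m := by
  induction m generalizing f with
  | zero => simp [binAvg, binKernel]
  | succ m ih =>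
    rw [← add_assoc, binAvg_succ hr, binAvg_succ hr _ m, ih, ih]
    simp only [add_assoc]

theorem enorm_binKernel {α : ℝ} (hα : 0 ≤ α) (n j : ℕ) {r : ℝ} (hr : r ∈ Set.Ioo (0 : ℝ) 1) :
    ‖(binKernel α n j r : ℂ)‖ₑ = ENNReal.ofReal (binKernel α n j r) := by
  rw [← ofReal_norm, Complex.norm_real,
    Real.norm_of_nonneg (binKernel_nonneg hα n j hr.1.le hr.2.le)]

theorem norm_binAvg_le {r : ℝ} (hr : r ∈ Set.Ioo (0 : ℝ) 1) {f : ℕ → ℂ} {C : ℝ}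
    (hf : ∀ n, ‖f n‖ ≤ C) (n : ℕ) : ‖binAvg r f n‖ ≤ C := by
  calc ‖binAvg r f n‖ ≤ ∑ j ∈ Finset.range (n + 1), binKernel 0 n j r * C := by
        refine norm_sum_le_of_le _ fun j _ => ?_
        have := binKernel_nonneg le_rfl n j hr.1.le hr.2.le
        rw [norm_mul, Complex.norm_real, Real.norm_of_nonneg this]
        exact mul_le_mul_of_nonneg_left (hf j) this
    _ = C := by rw [← Finset.sum_mul, sum_binKernel_zero n hr.1, one_mul]

/-- After `cesaroReal_mul_choose` extracts `k^{-α}(i)`, the binomial series contributes `r^{α-i}`,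
which combines with `r^i`. -/
theorem tsum_cesaroReal_mul_binKernel (α : ℝ) (i : ℕ) {r : ℝ} (hr : r ∈ Set.Ioo (0 : ℝ) 1) :
    ∑' m, (cesaroReal (-α) m : ℂ) * (binKernel 0 m i r : ℂ) = (r ^ α * cesaroReal (-α) i : ℝ) := by
  have hs := (hasSum_cesaroReal_mul_pow (-α + i) (y := 1 - r)
    (by rw [abs_of_nonneg] <;> linarith [hr.1, hr.2])).mul_left (cesaroReal (-α) i * r ^ i)
  rw [sub_sub_cancel, mul_assoc, ← Real.rpow_natCast, ← Real.rpow_add hr.1,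
    show (i : ℝ) + -(-α + i) = α by ring, mul_comm (cesaroReal (-α) i) (r ^ α)] at hs
  rw [← hs.tsum_eq, Complex.ofReal_tsum]
  rw [tsum_nat_of_eq_zero_of_lt (j := i) fun n hn => by simp [binKernel_of_lt 0 hn]]
  refine tsum_congr fun m => ?_
  rw [binKernel_zero_add, ← Complex.ofReal_mul, ← mul_assoc, ← mul_assoc, cesaroReal_mul_choose,
    Real.rpow_natCast]
  congr 1
  ring

/-- `W^α` commutes with binomial averaging up to the factor `r^α`. By `binAvg_add` the value at `n +
m` is a binomial average in `i`, with weights depending on `m`, of quantities free of `m`; summing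
over `m` first leaves `r^α k^{-α}(i)`. -/
theorem weylDiff_binAvg {α : ℝ} (hα : 0 ≤ α) {f : ℕ → ℂ} {C : ℝ} (hf : ∀ n, ‖f n‖ ≤ C) {r : ℝ}
    (hr : r ∈ Set.Ioo (0 : ℝ) 1) (n : ℕ) :
    weylDiff α (binAvg r f) n = (r ^ α : ℝ) * binAvg r (weylDiff α f) n := by
  -- The `n`-trial average of the `i`-th translate of `f`: the part that does not depend on `m`.
  set G : ℕ → ℂ := fun i => binAvg r (fun k => f (k + i)) n with hG
  have hGC : ∀ i, ‖G i‖ ≤ C := fun i => norm_binAvg_le hr (fun k => hf _) n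
  have hfin : ∑' m, ∑' i, ‖(cesaroReal (-α) m : ℂ) * ((binKernel 0 m i r : ℂ) * G i)‖ₑ ≠ ∞ := by
    refine ne_top_of_le_ne_top (ENNReal.mul_ne_top (tsum_enorm_cesaroReal_neg_ne_top hα)
      (ENNReal.ofReal_ne_top (r := C))) ?_
    rw [← ENNReal.tsum_mul_right]
    refine ENNReal.tsum_le_tsum fun m => ?_
    simp_rw [enorm_mul (cesaroReal (-α) m : ℂ)]
    rw [ENNReal.tsum_mul_left]
    refine mul_le_mul_right ?_ _
    calc ∑' i, ‖(binKernel 0 m i r : ℂ) * G i‖ₑ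
        ≤ ∑' i, ENNReal.ofReal (binKernel 0 m i r) * ENNReal.ofReal C := by
          refine ENNReal.tsum_le_tsum fun i => ?_
          rw [enorm_mul, enorm_binKernel le_rfl m i hr, ← ofReal_norm (G i)]
          exact mul_le_mul_right (ENNReal.ofReal_le_ofReal (hGC i)) _
      _ ≤ _ := by
          rw [ENNReal.tsum_mul_right]
          exact mul_le_of_le_one_left' (tsum_ofReal_binKernel_row_le le_rfl m hr)
  have hrow : ∀ m, binAvg r f (n + m) = ∑' i, (binKernel 0 m i r : ℂ) * G i := by
    intro m
    rw [binAvg_add hr.1, binAvg, tsum_eq_sum fun j hj => ?_]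
    rw [binKernel_of_lt 0 (by simpa [Nat.lt_succ_iff] using hj)]
    simp
  calc weylDiff α (binAvg r f) n
      = ∑' m, ∑' i, (cesaroReal (-α) m : ℂ) * ((binKernel 0 m i r : ℂ) * G i) := by
        rw [weylDiff_eq]
        simp_rw [hrow, tsum_mul_left]
    _ = ∑' i, ∑' m, (cesaroReal (-α) m : ℂ) * ((binKernel 0 m i r : ℂ) * G i) :=
        (summable_of_tsum_tsum_enorm_ne_top hfin).tsum_comm.symm
    _ = ∑' i, (r ^ α : ℝ) * ((cesaroReal (-α) i : ℂ) * G i) := by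
        refine tsum_congr fun i => ?_
        simp_rw [← mul_assoc]
        rw [tsum_mul_right, tsum_cesaroReal_mul_binKernel α i hr]
        push_cast
        rfl
    _ = (r ^ α : ℝ) * binAvg r (weylDiff α f) n := by
        rw [tsum_mul_left, binAvg]
        congr 1
        have hs := fun j => summable_weylDiff hα hf j
        simp_rw [cesaroNumber_neg_ofReal] at hs
        simp_rw [weylDiff_eq, hG, binAvg, ← tsum_mul_left, Finset.mul_sum]
        rw [← Summable.tsum_finsetSum fun j _ => (hs j).mul_left _]
        refine tsum_congr fun i => Finset.sum_congr rfl fun j _ => ?_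
        ring

theorem cesaroReal_mul_binKernel (α : ℝ) (n j : ℕ) {r : ℝ} (hr : 0 < r) :
    cesaroReal (α + 1) n * (r ^ α * binKernel 0 n j r) =
      binKernel α n j r * cesaroReal (α + 1) j := by
  rcases le_or_gt j n with h | h
  · obtain ⟨m, rfl⟩ := Nat.exists_eq_add_of_le h
    rw [binKernel_zero_add, binKernel_add, Real.rpow_add hr, Real.rpow_natCast]
    linear_combination (r ^ α * r ^ j * (1 - r) ^ m) * cesaroReal_mul_choose (α + 1) j m
  · simp [binKernel_of_lt _ h]

theorem weightedDiff_binAvg {α : ℝ} (hα : 0 ≤ α) {f : ℕ → ℂ} {C : ℝ} (hf : ∀ n, ‖f n‖ ≤ C) {r : ℝ}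
    (hr : r ∈ Set.Ioo (0 : ℝ) 1) (n : ℕ) :
    weightedDiff α (binAvg r f) n =
      ∑ j ∈ Finset.range (n + 1), (binKernel α n j r : ℂ) * weightedDiff α f j := by
  rw [weightedDiff, weylDiff_binAvg hα hf hr, binAvg, Finset.mul_sum, Finset.mul_sum]
  refine Finset.sum_congr rfl fun j _ => ?_
  rw [weightedDiff, cesaroNumber_ofReal_add_one, cesaroNumber_ofReal_add_one]
  have := congrArg (fun x : ℝ => (x : ℂ)) (cesaroReal_mul_binKernel α n j hr.1)
  push_cast at this ⊢
  linear_combination weylDiff α f j * this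

/-! ### Operators dominated by averaged binomial kernels -/

theorem memℓp_and_norm_le {p : ℝ≥0∞} (hp : 1 ≤ p) {F : ℕ → ℂ} (h : lp (fun _ : ℕ => ℂ) p)
    {e : ℕ → ℕ → ℝ≥0∞} {β : ℂ} {M : ℝ} (hM : 0 ≤ M)
    (hF : ∀ n, ‖F n‖ₑ ≤ ‖β‖ₑ * ∑' j, e n j * ‖h j‖ₑ)
    (he : seqNorm p (fun n => ∑' j, e n j * ‖h j‖ₑ) ≤
      ENNReal.ofReal M * seqNorm p (fun n => ‖h n‖ₑ)) :
    ∃ hm : Memℓp F p, ‖(⟨F, hm⟩ : lp (fun _ : ℕ => ℂ) p)‖ ≤ ‖β‖ * M * ‖h‖ := by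
  have h1 : seqNorm p (fun n => ‖F n‖ₑ) ≤ ENNReal.ofReal (‖β‖ * M * ‖h‖) := by
    refine (seqNorm_mono hF).trans ?_
    rw [seqNorm_const_mul hp, mul_assoc, ENNReal.ofReal_mul (norm_nonneg _),
      ENNReal.ofReal_mul hM, ofReal_norm β, ← seqNorm_enorm hp]
    exact mul_le_mul_right he _
  have hm := memℓp_of_seqNorm_ne_top hp (ne_top_of_le_ne_top ENNReal.ofReal_ne_top h1)
  refine ⟨hm, ?_⟩
  have h2 := seqNorm_enorm hp (⟨F, hm⟩ : lp (fun _ : ℕ => ℂ) p)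
  simp only at h2
  rw [h2] at h1
  exact (ENNReal.ofReal_le_ofReal_iff
    (mul_nonneg (mul_nonneg (norm_nonneg _) hM) (lp.norm_nonneg' h))).1 h1

/-- Schur's test with `θ = 1/p`, row exponent `1 - θ` and column exponent `2 - θ`, since `(1-θ)² +
θ(2-θ) = 1`. -/
theorem seqNorm_betaAvg_le {p : ℝ≥0∞} (hp : 1 < p) {α b : ℝ} (hα : 0 ≤ α) (hb : 0 < b)
    (h : ℕ → ℝ≥0∞) :
    seqNorm p (fun n => ∑' j, betaAvg α b 1 n j * h j) ≤
      ENNReal.ofReal (Real.Gamma b * Real.Gamma (1 - invExp p) / Real.Gamma (b + (1 - invExp p))) *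
        seqNorm p h := by
  have h1 := sub_pos.2 (invExp_lt_one hp)
  exact seqNorm_tsum_le hp.le (e₁ := betaAvg α b (1 - invExp p))
    (e₂ := betaAvg α b (1 - invExp p + 1))
    (betaAvg_le_mul (invExp_nonneg p) (invExp_le_one hp.le) (by ring))
    (tsum_betaAvg_row_le hα hb h1) (fun _ => tsum_betaAvg_column_le hα hb h1) h

/-- Rows and columns trade places, so the exponents become `1 + θ` and `θ` with `θ = 1/p`, since
`(1-θ)(1+θ) + θ² = 1`. -/
theorem seqNorm_betaAvg_transpose_le {p : ℝ≥0∞} (hp : 1 ≤ p) (hp' : p ≠ ∞) {b : ℝ} (hb : 0 < b)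
    (h : ℕ → ℝ≥0∞) :
    seqNorm p (fun n => ∑' j, betaAvg 0 b 1 j n * h j) ≤
      ENNReal.ofReal (Real.Gamma b * Real.Gamma (invExp p) / Real.Gamma (b + invExp p)) *
        seqNorm p h := by
  have h1 := invExp_pos hp hp'
  exact seqNorm_tsum_le hp (e₁ := fun n j => betaAvg 0 b (invExp p + 1) j n)
    (e₂ := fun n j => betaAvg 0 b (invExp p) j n)
    (fun n j => betaAvg_le_mul (invExp_nonneg p) (invExp_le_one hp) (by ring) j n)
    (tsum_betaAvg_column_le le_rfl hb h1) (fun _ => tsum_betaAvg_row_le le_rfl hb h1) h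

/-! ### The Cesàro operator -/

theorem cesaro_eq_sum {β : ℂ} (hβ : 0 < β.re) (f : ℕ → ℂ) (n : ℕ) :
    cesaro β f n = ∑ j ∈ Finset.range (n + 1), hausCoef β 0 n j * f j := by
  rw [cesaro, Finset.mul_sum]
  refine Finset.sum_congr rfl fun j hj => ?_
  obtain ⟨m, rfl⟩ := Nat.exists_eq_add_of_le (Nat.lt_succ_iff.1 (Finset.mem_range.1 hj))
  rw [hausCoef_zero_add hβ, Nat.add_sub_cancel_left]
  ring

theorem integrableOn_betaWeight_mul_sum {α : ℝ} (hα : 0 ≤ α) {β : ℂ} (hβ : 0 < β.re) (f : ℕ → ℂ)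
    (n : ℕ) :
    IntegrableOn (fun r => betaWeight β r *
      ∑ j ∈ Finset.range (n + 1), (binKernel α n j r : ℂ) * f j) (Set.Ioo (0 : ℝ) 1) := by
  simp_rw [Finset.mul_sum, ← mul_assoc]
  exact integrable_finsetSum _ fun j _ =>
    (integrableOn_betaWeight_mul_binKernel hα hβ n j).mul_const _

theorem mul_integral_betaWeight_mul_sum {α : ℝ} (hα : 0 ≤ α) {β : ℂ} (hβ : 0 < β.re) (f : ℕ → ℂ)
    (n : ℕ) :
    β * ∫ r in Set.Ioo (0 : ℝ) 1, betaWeight β r *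
      ∑ j ∈ Finset.range (n + 1), (binKernel α n j r : ℂ) * f j =
    ∑ j ∈ Finset.range (n + 1), hausCoef β α n j * f j := by
  simp_rw [Finset.mul_sum, ← mul_assoc]
  rw [integral_finsetSum _ fun j _ =>
    (integrableOn_betaWeight_mul_binKernel hα hβ n j).mul_const _, Finset.mul_sum]
  refine Finset.sum_congr rfl fun j _ => ?_
  rw [integral_mul_const, hausCoef, mul_assoc]

theorem integrableOn_betaWeight_mul_binAvg {β : ℂ} (hβ : 0 < β.re) (f : ℕ → ℂ) (n : ℕ) :
    IntegrableOn (fun r => betaWeight β r * binAvg r f n) (Set.Ioo (0 : ℝ) 1) :=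
  integrableOn_betaWeight_mul_sum le_rfl hβ f n

theorem cesaro_eq_integral {β : ℂ} (hβ : 0 < β.re) (f : ℕ → ℂ) (n : ℕ) :
    cesaro β f n = β * ∫ r in Set.Ioo (0 : ℝ) 1, betaWeight β r * binAvg r f n := by
  rw [cesaro_eq_sum hβ, ← mul_integral_betaWeight_mul_sum le_rfl hβ]
  rfl

theorem lintegral_enorm_betaWeight_ne_top {β : ℂ} (hβ : 0 < β.re) :
    ∫⁻ r in Set.Ioo (0 : ℝ) 1, ‖betaWeight β r‖ₑ ≠ ∞ := by
  rw [setLIntegral_congr_fun measurableSet_Ioo fun r hr => enorm_betaWeight β hr.2,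
    lintegral_beta hβ one_pos]
  exact ENNReal.ofReal_ne_top

theorem integrableOn_betaWeight {β : ℂ} (hβ : 0 < β.re) :
    IntegrableOn (betaWeight β) (Set.Ioo (0 : ℝ) 1) :=
  ⟨by fun_prop, by
    rw [hasFiniteIntegral_iff_enorm]; exact (lintegral_enorm_betaWeight_ne_top hβ).lt_top⟩

theorem weightedDiff_cesaro {α : ℝ} (hα : 0 ≤ α) {β : ℂ} (hβ : 0 < β.re) {f : ℕ → ℂ} {C : ℝ}
    (hf : ∀ n, ‖f n‖ ≤ C) (n : ℕ) :
    weightedDiff α (cesaro β f) n =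
      ∑ j ∈ Finset.range (n + 1), hausCoef β α n j * weightedDiff α f j := by
  -- Fubini hypothesis, with majorant `∑ |k^{-α}| · ∫ |(1-r)^{β-1}| · C`: it moves `W^α` inside the
  -- integral over `r`.
  have hfin : ∑' i, ∫⁻ r in Set.Ioo (0 : ℝ) 1,
      ‖(cesaroReal (-α) i : ℂ) * (betaWeight β r * binAvg r f (n + i))‖ₑ ≠ ∞ := by
    refine ne_top_of_le_ne_top (ENNReal.mul_ne_top (tsum_enorm_cesaroReal_neg_ne_top hα)
      (ENNReal.mul_ne_top (lintegral_enorm_betaWeight_ne_top hβ)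
      (ENNReal.ofReal_ne_top (r := C)))) ?_
    rw [← ENNReal.tsum_mul_right]
    refine ENNReal.tsum_le_tsum fun i => ?_
    rw [← lintegral_mul_const _ (by fun_prop), ← lintegral_const_mul _ (by fun_prop)]
    refine setLIntegral_mono' measurableSet_Ioo fun r hr => ?_
    rw [enorm_mul, enorm_mul, ← ofReal_norm (binAvg r f (n + i))]
    gcongr
    exact norm_binAvg_le hr hf _
  have hint : weylDiff α (cesaro β f) n =
      β * ∫ r in Set.Ioo (0 : ℝ) 1, betaWeight β r * weylDiff α (binAvg r f) n := by
    rw [weylDiff_eq]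
    simp_rw [cesaro_eq_integral hβ, mul_left_comm _ β]
    rw [tsum_mul_left]
    congr 1
    simp_rw [← integral_const_mul]
    rw [← integral_tsum (fun i =>
      ((integrableOn_betaWeight_mul_binAvg hβ f (n + i)).const_mul _).1) hfin]
    simp_rw [weylDiff_eq, ← tsum_mul_left, mul_left_comm]
  rw [weightedDiff, hint, ← mul_integral_betaWeight_mul_sum hα hβ, mul_left_comm,
    ← integral_const_mul]
  congr 1
  refine setIntegral_congr_fun measurableSet_Ioo fun r hr => ?_
  rw [← weightedDiff_binAvg hα hf hr, weightedDiff, mul_left_comm]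

/-- Toeplitz's argument: finitely many columns vanish in the limit, and on the rest `f` is small
while the rows stay bounded. -/
theorem tendsto_sum_mul_zero {A : ℕ → ℕ → ℂ} {C : ℝ}
    (hA : ∀ n, ∑ j ∈ Finset.range (n + 1), ‖A n j‖ ≤ C)
    (hA' : ∀ j, Tendsto (fun n => A n j) atTop (𝓝 0)) {f : ℕ → ℂ} (hf : Tendsto f atTop (𝓝 0)) :
    Tendsto (fun n => ∑ j ∈ Finset.range (n + 1), A n j * f j) atTop (𝓝 0) := by
  have hC : 0 ≤ C := (Finset.sum_nonneg fun _ _ => norm_nonneg _).trans (hA 0)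
  rw [Metric.tendsto_atTop]
  intro ε hε
  -- `C + 1` rather than `C` keeps the denominator positive when `C = 0`.
  obtain ⟨N, hN⟩ := (Metric.tendsto_atTop.1 hf) (ε / (2 * (C + 1))) (by positivity)
  have h1 : Tendsto (fun n => ∑ j ∈ Finset.range N, ‖A n j * f j‖) atTop (𝓝 0) := by
    have := tendsto_finsetSum (Finset.range N) fun j _ => ((hA' j).mul_const (f j)).norm
    simpa using this
  obtain ⟨N', hN'⟩ := (Metric.tendsto_atTop.1 h1) (ε / 2) (by positivity)
  refine ⟨max N N', fun n hn => ?_⟩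
  have hnN : N ≤ n + 1 := ((le_max_left _ _).trans hn).trans n.le_succ
  have h2 := hN' n ((le_max_right _ _).trans hn)
  rw [Real.dist_eq, sub_zero] at h2
  rw [dist_zero_right]
  calc ‖∑ j ∈ Finset.range (n + 1), A n j * f j‖
      ≤ ∑ j ∈ Finset.range (n + 1), ‖A n j * f j‖ := norm_sum_le _ _
    _ = ∑ j ∈ Finset.range N, ‖A n j * f j‖ + ∑ j ∈ Finset.Ico N (n + 1), ‖A n j * f j‖ :=
        (Finset.sum_range_add_sum_Ico _ hnN).symm
    _ ≤ ∑ j ∈ Finset.range N, ‖A n j * f j‖ +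
        ∑ j ∈ Finset.Ico N (n + 1), ‖A n j‖ * (ε / (2 * (C + 1))) := by
        gcongr with j hj
        rw [norm_mul]
        gcongr
        have := hN j (Finset.mem_Ico.1 hj).1
        rw [dist_zero_right] at this
        exact this.le
    _ ≤ ∑ j ∈ Finset.range N, ‖A n j * f j‖ + C * (ε / (2 * (C + 1))) := by
        rw [← Finset.sum_mul]
        gcongr
        refine (Finset.sum_le_sum_of_subset_of_nonneg ?_ fun _ _ _ => norm_nonneg _).trans (hA n)
        intro j hj
        simpa using (Finset.mem_Ico.1 hj).2
    _ < ε / 2 + ε / 2 := by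
        refine add_lt_add_of_lt_of_le ((le_abs_self _).trans_lt h2) ?_
        rw [mul_div_assoc', div_le_div_iff₀ (by positivity) two_pos]
        nlinarith
    _ = ε := add_halves ε

theorem tendsto_binAvg {r : ℝ} (hr : r ∈ Set.Ioo (0 : ℝ) 1) {f : ℕ → ℂ}
    (hf : Tendsto f atTop (𝓝 0)) : Tendsto (binAvg r f) atTop (𝓝 0) := by
  refine tendsto_sum_mul_zero (C := 1) (fun n => ?_) (fun j => ?_) hf
  · rw [← sum_binKernel_zero n hr.1]
    refine Finset.sum_le_sum fun j _ => ?_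
    rw [Complex.norm_real, Real.norm_of_nonneg (binKernel_nonneg le_rfl n j hr.1.le hr.2.le)]
  · have h := (hasSum_binKernel_column 0 j hr).summable.tendsto_atTop_zero
    simp_rw [add_comm j] at h
    rw [tendsto_add_atTop_iff_nat (f := fun n => binKernel 0 n j r) j] at h
    exact_mod_cast (Complex.continuous_ofReal.tendsto 0).comp h

theorem tendsto_cesaro {β : ℂ} (hβ : 0 < β.re) {f : ℕ → ℂ} (hf : Tendsto f atTop (𝓝 0)) :
    Tendsto (cesaro β f) atTop (𝓝 0) := by
  obtain ⟨C, hC⟩ := exists_norm_le_of_tendsto hf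
  have h := tendsto_integral_of_dominated_convergence (μ := volume.restrict (Set.Ioo (0 : ℝ) 1))
    (F := fun n r => betaWeight β r * binAvg r f n) (f := fun _ => 0)
    (fun r => ‖betaWeight β r‖ * C)
    (fun n => (integrableOn_betaWeight_mul_binAvg hβ f n).1)
    ((integrableOn_betaWeight hβ).norm.mul_const C)
    (fun n => (ae_restrict_iff' measurableSet_Ioo).2 (.of_forall fun r hr => by
      rw [norm_mul]
      exact mul_le_mul_of_nonneg_left (norm_binAvg_le hr hC n) (norm_nonneg _)))
    ((ae_restrict_iff' measurableSet_Ioo).2 (.of_forall fun r hr => by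
      simpa using (tendsto_binAvg hr hf).const_mul (betaWeight β r)))
  rw [integral_zero] at h
  have h' := h.const_mul β
  rw [mul_zero] at h'
  exact h'.congr fun n => (cesaro_eq_integral hβ f n).symm

namespace Tau

variable {α : ℝ} {p : ℝ≥0∞}

theorem exists_norm_seq_le (hα : 0 ≤ α) (hp : 1 ≤ p) (f : Tau α p) : ∃ C, ∀ n, ‖f.seq n‖ ≤ C := by
  rcases hα.eq_or_lt with rfl | h
  · have h := f.2.2.2
    rw [weightedDiff_zero] at h
    exact ⟨_, fun n => lp.norm_apply_le_norm (by rintro rfl; simp at hp)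
      (⟨_, h⟩ : lp (fun _ : ℕ => ℂ) p) n⟩
  · exact exists_norm_le_of_tendsto (f.2.1 h)

/-- A linear map on `τ_p^α` whose action on weighted differences is bounded extends to a bounded
operator. -/
theorem exists_continuousLinearMap [Fact (1 ≤ p)] (T : (ℕ → ℂ) → ℕ → ℂ)
    (hadd : ∀ f g : Tau α p, T (f + g).seq = T f.seq + T g.seq)
    (hsmul : ∀ (c : ℂ) (f : Tau α p), T (c • f).seq = c • T f.seq)
    (hmem : ∀ f : Tau α p, (0 < α → Tendsto (T f.seq) atTop (𝓝 0)) ∧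
      ∀ n, Summable fun j : ℕ => cesaroNumber (-(α : ℂ)) j * T f.seq (n + j))
    {K : ℝ} (hK : 0 ≤ K) (hbound : ∀ f : Tau α p, ∃ hm : Memℓp (weightedDiff α (T f.seq)) p,
      ‖(⟨_, hm⟩ : lp (fun _ : ℕ => ℂ) p)‖ ≤ K * ‖toLp α p f‖) :
    ∃ L : Tau α p →L[ℂ] Tau α p, (∀ f : Tau α p, (L f).seq = T f.seq) ∧ ‖L‖ ≤ K := by
  let L₀ : Tau α p →ₗ[ℂ] Tau α p :=
    { toFun := fun f => (⟨T f.seq, (hmem f).1, (hmem f).2, (hbound f).choose⟩ : tauSubmodule α p)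
      map_add' := fun f g => Subtype.ext (hadd f g)
      map_smul' := fun c f => Subtype.ext (hsmul c f) }
  exact ⟨L₀.mkContinuous K fun f => (hbound f).choose_spec, fun f => rfl,
    LinearMap.mkContinuous_norm_le _ hK _⟩

end Tau

theorem exists_cesaro_operator {α : ℝ} (hα : 0 ≤ α) {β : ℂ} (hβ : 0 < β.re) {p : ℝ≥0∞}
    [Fact (1 ≤ p)] (hp : 1 < p) :
    ∃ L : Tau α p →L[ℂ] Tau α p, (∀ f : Tau α p, (L f).seq = cesaro β f.seq) ∧
      ‖L‖ ≤ ‖β‖ * (Real.Gamma β.re * Real.Gamma (1 - invExp p) /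
        Real.Gamma (β.re + (1 - invExp p))) := by
  have h1 := sub_pos.2 (invExp_lt_one hp)
  have hM : 0 ≤ Real.Gamma β.re * Real.Gamma (1 - invExp p) /
      Real.Gamma (β.re + (1 - invExp p)) := by positivity
  refine Tau.exists_continuousLinearMap (cesaro β) (fun f g => ?_) (fun c f => ?_) (fun f => ?_)
    (by positivity) fun f => ?_
  · funext n
    have : (f + g).seq = f.seq + g.seq := rfl
    simp only [cesaro, this, Pi.add_apply, mul_add, Finset.sum_add_distrib]
  · funext n
    have : (c • f).seq = c • f.seq := rfl
    simp only [cesaro, this, Pi.smul_apply, smul_eq_mul, mul_left_comm _ c, ← Finset.mul_sum]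
  · obtain ⟨C, hC⟩ := f.exists_norm_seq_le hα hp.le
    refine ⟨fun h => tendsto_cesaro hβ (f.2.1 h), fun n => ?_⟩
    refine summable_weylDiff hα
      (C := ‖β‖ * ((∫ r in Set.Ioo (0 : ℝ) 1, ‖betaWeight β r‖) * C)) (fun n => ?_) n
    rw [cesaro_eq_integral hβ, norm_mul, ← integral_mul_const]
    gcongr
    refine norm_integral_le_of_norm_le ((integrableOn_betaWeight hβ).norm.mul_const C)
      ((ae_restrict_iff' measurableSet_Ioo).2 (.of_forall fun r hr => ?_))
    rw [norm_mul]
    exact mul_le_mul_of_nonneg_left (norm_binAvg_le hr hC n) (norm_nonneg _)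
  · obtain ⟨C, hC⟩ := f.exists_norm_seq_le hα hp.le
    refine memℓp_and_norm_le hp.le (Tau.toLp α p f) hM (fun n => ?_)
      (seqNorm_betaAvg_le hp hα hβ _)
    rw [weightedDiff_cesaro hα hβ hC, ← ENNReal.tsum_mul_left]
    refine (enorm_sum_le _ _).trans ((ENNReal.sum_le_tsum _).trans ?_)
    refine ENNReal.tsum_le_tsum fun j => ?_
    rw [enorm_mul, ← mul_assoc]
    exact mul_le_mul_left (enorm_hausCoef_le hα β n j) _

/-! ### The dual Cesàro operator -/

theorem dualCesaroTerm_eq {β : ℂ} (hβ : 0 < β.re) (f : ℕ → ℂ) (n j : ℕ) :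
    dualCesaroTerm β f n j = hausCoef β 0 (n + j) n * f (n + j) := by
  rw [dualCesaroTerm, hausCoef_zero_add hβ]

theorem dualCesaro_eq_tsum {β : ℂ} (hβ : 0 < β.re) (f : ℕ → ℂ) (n : ℕ) :
    dualCesaro β f n = ∑' j, hausCoef β 0 j n * f j := by
  rw [tsum_nat_of_eq_zero_of_lt (j := n) fun j hj => by rw [hausCoef_of_lt β 0 hj, zero_mul]]
  exact tsum_congr fun j => dualCesaroTerm_eq hβ f n j

theorem tsum_enorm_hausCoef_mul_le (β : ℂ) (h : ℕ → ℂ) (n : ℕ) :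
    ∑' j, ‖hausCoef β 0 j n * h j‖ₑ ≤ ‖β‖ₑ * ∑' j, betaAvg 0 β.re 1 j n * ‖h j‖ₑ := by
  rw [← ENNReal.tsum_mul_left]
  refine ENNReal.tsum_le_tsum fun j => ?_
  rw [enorm_mul, ← mul_assoc]
  exact mul_le_mul_left (enorm_hausCoef_le le_rfl β j n) _

theorem exists_tsum_enorm_hausCoef_mul_le {p : ℝ≥0∞} (hp : 1 ≤ p) (hp' : p ≠ ∞) {β : ℂ}
    (hβ : 0 < β.re) {h : ℕ → ℂ} (hh : Memℓp h p) :
    ∃ C : ℝ≥0∞, C ≠ ∞ ∧ ∀ n, ∑' j, ‖hausCoef β 0 j n * h j‖ₑ ≤ C :=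
  ⟨_, ENNReal.mul_ne_top enorm_ne_top (ENNReal.mul_ne_top ENNReal.ofReal_ne_top
    (seqNorm_ne_top hp hh)), fun n => (tsum_enorm_hausCoef_mul_le β h n).trans
    (mul_le_mul_right ((le_seqNorm hp (fun n => ∑' j, betaAvg 0 β.re 1 j n * ‖h j‖ₑ) n).trans
      (seqNorm_betaAvg_transpose_le hp hp' hβ _)) _)⟩

theorem memℓp_dualCesaro_and_norm_le {p : ℝ≥0∞} (hp : 1 ≤ p) (hp' : p ≠ ∞) {β : ℂ} (hβ : 0 < β.re)
    (h : lp (fun _ : ℕ => ℂ) p) :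
    ∃ hm : Memℓp (dualCesaro β h) p, ‖(⟨_, hm⟩ : lp (fun _ : ℕ => ℂ) p)‖ ≤
      ‖β‖ * (Real.Gamma β.re * Real.Gamma (invExp p) / Real.Gamma (β.re + invExp p)) * ‖h‖ := by
  have h1 := invExp_pos hp hp'
  refine memℓp_and_norm_le hp h (by positivity) (fun n => ?_)
    (seqNorm_betaAvg_transpose_le hp hp' hβ _)
  rw [dualCesaro_eq_tsum hβ]
  exact enorm_tsum_le_tsum_enorm.trans (tsum_enorm_hausCoef_mul_le β h n)

theorem Memℓp.dualCesaro {p : ℝ≥0∞} (hp : 1 ≤ p) (hp' : p ≠ ∞) {β : ℂ} (hβ : 0 < β.re) {h : ℕ → ℂ}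
    (hh : Memℓp h p) :
    Memℓp (dualCesaro β h) p :=
  (memℓp_dualCesaro_and_norm_le hp hp' hβ ⟨h, hh⟩).choose

theorem tendsto_zero_of_memℓp {p : ℝ≥0∞} (hp : 1 ≤ p) (hp' : p ≠ ∞) {h : ℕ → ℂ} (hh : Memℓp h p)
    : Tendsto h atTop (𝓝 0) := by
  have h0 := toReal_pos_of_one_le hp hp'
  have h1 := ((hh.summable h0).tendsto_atTop_zero).rpow_const (p := 1 / p.toReal)
    (Or.inr (by positivity))
  rw [Real.zero_rpow (by positivity)] at h1
  refine tendsto_zero_iff_norm_tendsto_zero.2 (h1.congr fun n => ?_)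
  rw [← Real.rpow_mul (norm_nonneg _), mul_one_div_cancel h0.ne', Real.rpow_one]

/-- With `g = h / k^{α+1}`, `C_α^* h` is the fractional sum `∑ k^α(l) g(n+l)`, and `k^{-α} * k^α` is
the unit for convolution. Since `k^α` need not be summable, absolute convergence comes from the
Schur bound. -/
theorem weightedDiff_dualCesaro_self {p : ℝ≥0∞} (hp : 1 ≤ p) (hp' : p ≠ ∞) {α : ℝ} (hα : 0 < α)
    {h : ℕ → ℂ} (hh : Memℓp h p) :
    weightedDiff α (dualCesaro α h) = h := by
  have hα' : 0 < (α : ℂ).re := hα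
  have hk : ∀ n, cesaroNumber ((α : ℂ) + 1) n ≠ 0 := cesaroNumber_ne_zero (by simp; linarith)
  obtain ⟨C, hC, hCn⟩ := exists_tsum_enorm_hausCoef_mul_le hp hp' hα' hh
  set g : ℕ → ℂ := fun i => h i / cesaroNumber ((α : ℂ) + 1) i with hg
  have hterm : ∀ n l, hausCoef α 0 (n + l) n * h (n + l) = (cesaroReal α l : ℂ) * g (n + l) := by
    intro n l
    rw [hausCoef_zero_add hα', cesaroNumber_ofReal α l, hg]
    ring
  have hf : ∀ n, dualCesaro α h n = ∑' l, (cesaroReal α l : ℂ) * g (n + l) := fun n =>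
    tsum_congr fun l => by rw [dualCesaroTerm_eq hα', hterm]
  funext n
  rw [weightedDiff, weylDiff_eq]
  simp_rw [hf]
  rw [tsum_mul_tsum_shift n (tsum_weylDiff_conv_ne_top hα.le hC (fun n => ?_) n),
    tsum_eq_single 0 fun N hN => ?_]
  · simp [hg]
    field_simp [hk n]
  · have h1 := sum_antidiagonal_cesaroReal (-α) α N
    obtain ⟨i, rfl⟩ := Nat.exists_eq_succ_of_ne_zero hN
    rw [neg_add_cancel, cesaroReal_zero_succ] at h1
    have h2 := congrArg (fun x : ℝ => (x : ℂ)) h1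
    push_cast at h2
    rw [h2, zero_mul]
  · refine le_trans (le_of_eq ?_) (hCn n)
    rw [tsum_nat_of_eq_zero_of_lt (f := fun j => ‖hausCoef α 0 j n * h j‖ₑ) (j := n) fun j hj => by
      rw [hausCoef_of_lt _ 0 hj, zero_mul, enorm_zero]]
    simp_rw [hterm]

/-- Both sides are null sequences with the same Weyl difference of order `α`, and `W^α` is injective
on null sequences. -/
theorem eq_dualCesaro_weightedDiff {p : ℝ≥0∞} (hp : 1 ≤ p) (hp' : p ≠ ∞) {α : ℝ} (hα : 0 < α)
    {f : ℕ → ℂ} (hf : Tendsto f atTop (𝓝 0))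
    (hf' : Memℓp (weightedDiff α f) p) : f = dualCesaro α (weightedDiff α f) := by
  have hα' : 0 < (α : ℂ).re := hα
  have hk : ∀ n, cesaroNumber ((α : ℂ) + 1) n ≠ 0 := cesaroNumber_ne_zero (by simp; linarith)
  set g := dualCesaro α (weightedDiff α f) with hg
  have hg0 : Tendsto g atTop (𝓝 0) :=
    tendsto_zero_of_memℓp hp hp' (Memℓp.dualCesaro hp hp' hα' hf')
  obtain ⟨C, hC⟩ := exists_norm_le_of_tendsto hf
  obtain ⟨C', hC'⟩ := exists_norm_le_of_tendsto hg0
  have h0 : weylDiff α (f - g) = 0 := by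
    funext n
    have h1 := congrFun (weightedDiff_dualCesaro_self hp hp' hα hf') n
    rw [← hg, weightedDiff, weightedDiff] at h1
    have h2 := mul_left_cancel₀ (hk n) h1
    simp only [weylDiff, Pi.sub_apply, mul_sub] at h2 ⊢
    rw [(summable_weylDiff hα.le hC n).tsum_sub (summable_weylDiff hα.le hC' n), h2, sub_self]
    rfl
  exact sub_eq_zero.1 (eq_zero_of_weylDiff_eq_zero hα.le (by simpa using! hf.sub hg0) h0)

/-- Thinning a binomial variable twice multiplies the success probabilities. The proof expands `1 -
rs = r(1-s) + (1-r)`; symmetry in `r` and `s` then yields commutation. -/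
theorem sum_binKernel_mul_binKernel (n d : ℕ) (s r : ℝ) :
    ∑ m ∈ Finset.range (n + d + 1), binKernel 0 m n s * binKernel 0 (n + d) m r =
      ((n + d).choose n : ℝ) * (r * s) ^ n * (1 - r * s) ^ d := by
  rw [add_assoc, Finset.sum_range_add, Finset.sum_eq_zero fun m hm => by
      rw [binKernel_of_lt 0 (Finset.mem_range.1 hm), zero_mul], zero_add,
    show 1 - r * s = r * (1 - s) + (1 - r) by ring, add_pow, Finset.mul_sum]
  refine Finset.sum_congr rfl fun l hl => ?_
  obtain ⟨e, rfl⟩ := Nat.exists_eq_add_of_le (Nat.lt_succ_iff.1 (Finset.mem_range.1 hl))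
  have hc : ((n + (l + e)).choose (n + l) : ℝ) * ((n + l).choose n : ℝ) =
      ((n + (l + e)).choose n : ℝ) * ((l + e).choose l : ℝ) := by
    have := Nat.choose_mul (n := n + (l + e)) (k := n + l) (s := n) (by lia)
    rw [Nat.add_sub_cancel_left, Nat.add_sub_cancel_left] at this
    exact_mod_cast this
  rw [binKernel_zero_add, Nat.add_sub_cancel_left]
  rw [← add_assoc n l e] at hc ⊢
  rw [binKernel_zero_add]
  rw [mul_pow r (1 - s) l]
  linear_combination (s ^ n * (1 - s) ^ l * r ^ (n + l) * (1 - r) ^ e) * hc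

theorem sum_binKernel_mul_binKernel_comm (n j : ℕ) (s r : ℝ) :
    ∑ m ∈ Finset.range (j + 1), binKernel 0 m n s * binKernel 0 j m r =
      ∑ m ∈ Finset.range (j + 1), binKernel 0 m n r * binKernel 0 j m s := by
  rcases le_or_gt n j with h | h
  · obtain ⟨d, rfl⟩ := Nat.exists_eq_add_of_le h
    rw [sum_binKernel_mul_binKernel, sum_binKernel_mul_binKernel, mul_comm r s]
  · refine Finset.sum_congr rfl fun m hm => ?_
    have : m < n := by
      have := Finset.mem_range.1 hm
      lia
    rw [binKernel_of_lt 0 this, binKernel_of_lt 0 this, zero_mul, zero_mul]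

theorem sum_hausCoef_mul_hausCoef {a b : ℂ} (ha : 0 < a.re) (hb : 0 < b.re) (n j : ℕ) :
    ∑ m ∈ Finset.range (j + 1), hausCoef a 0 m n * hausCoef b 0 j m =
      a * b * ∫ z, betaWeight a z.1 * betaWeight b z.2 *
        ((∑ m ∈ Finset.range (j + 1), binKernel 0 m n z.1 * binKernel 0 j m z.2 : ℝ) : ℂ)
        ∂((volume.restrict (Set.Ioo (0 : ℝ) 1)).prod (volume.restrict (Set.Ioo (0 : ℝ) 1))) := by
  have h1 : ∀ z : ℝ × ℝ, betaWeight a z.1 * betaWeight b z.2 *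
      ((∑ m ∈ Finset.range (j + 1), binKernel 0 m n z.1 * binKernel 0 j m z.2 : ℝ) : ℂ) =
      ∑ m ∈ Finset.range (j + 1), (betaWeight a z.1 * (binKernel 0 m n z.1 : ℂ)) *
        (betaWeight b z.2 * (binKernel 0 j m z.2 : ℂ)) := by
    intro z
    push_cast
    rw [Finset.mul_sum]
    exact Finset.sum_congr rfl fun m _ => by ring
  simp_rw [h1]
  rw [integral_finsetSum _ fun m _ =>
    (integrableOn_betaWeight_mul_binKernel le_rfl ha m n).mul_prod
      (integrableOn_betaWeight_mul_binKernel le_rfl hb j m), Finset.mul_sum]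
  refine Finset.sum_congr rfl fun m _ => ?_
  rw [integral_prod_mul (fun s => betaWeight a s * (binKernel 0 m n s : ℂ))
    (fun r => betaWeight b r * (binKernel 0 j m r : ℂ)), hausCoef, hausCoef]
  ring

theorem sum_hausCoef_mul_hausCoef_comm {a b : ℂ} (ha : 0 < a.re) (hb : 0 < b.re) (n j : ℕ) :
    ∑ m ∈ Finset.range (j + 1), hausCoef a 0 m n * hausCoef b 0 j m =
      ∑ m ∈ Finset.range (j + 1), hausCoef b 0 m n * hausCoef a 0 j m := by
  rw [sum_hausCoef_mul_hausCoef ha hb, sum_hausCoef_mul_hausCoef hb ha, ← integral_prod_swap,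
    mul_comm a b]
  congr 2
  funext z
  simp only [Prod.fst_swap, Prod.snd_swap]
  rw [sum_binKernel_mul_binKernel_comm n j z.2 z.1, mul_comm (betaWeight a z.2)]

theorem dualCesaro_dualCesaro {p : ℝ≥0∞} (hp : 1 ≤ p) (hp' : p ≠ ∞) {a b : ℂ} (ha : 0 < a.re)
    (hb : 0 < b.re) {h : ℕ → ℂ} (hh : Memℓp h p) (n : ℕ) :
    dualCesaro a (dualCesaro b h) n =
      ∑' j, (∑ m ∈ Finset.range (j + 1), hausCoef a 0 m n * hausCoef b 0 j m) * h j := by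
  have hfin : ∑' m, ∑' j, ‖hausCoef a 0 m n * (hausCoef b 0 j m * h j)‖ₑ ≠ ∞ := by
    -- The averaged kernel applied to `|h|`. The Schur bound puts `H` in `ℓ^p`, and a second use of
    -- it controls the double sum.
    set H : ℕ → ℝ≥0∞ := fun m => ∑' j, betaAvg 0 b.re 1 j m * ‖h j‖ₑ with hH
    have hb' := seqNorm_betaAvg_transpose_le hp hp' hb fun j => ‖h j‖ₑ
    have ha' := (le_seqNorm hp _ n).trans (seqNorm_betaAvg_transpose_le hp hp' ha H)
    have hH' : seqNorm p H ≠ ∞ := ne_top_of_le_ne_top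
      (ENNReal.mul_ne_top ENNReal.ofReal_ne_top (seqNorm_ne_top hp hh)) hb'
    have h2 := ne_top_of_le_ne_top (ENNReal.mul_ne_top ENNReal.ofReal_ne_top hH') ha'
    refine ne_top_of_le_ne_top (ENNReal.mul_ne_top (ENNReal.mul_ne_top (enorm_ne_top (x := a))
      (enorm_ne_top (x := b))) h2) ?_
    rw [← ENNReal.tsum_mul_left]
    refine ENNReal.tsum_le_tsum fun m => ?_
    simp_rw [enorm_mul (hausCoef a 0 m n)]
    rw [ENNReal.tsum_mul_left]
    calc _ ≤ ‖a‖ₑ * betaAvg 0 a.re 1 m n * (‖b‖ₑ * H m) :=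
          mul_le_mul' (enorm_hausCoef_le le_rfl a m n) (tsum_enorm_hausCoef_mul_le b h m)
      _ = _ := by ring
  rw [dualCesaro_eq_tsum ha]
  simp_rw [dualCesaro_eq_tsum hb, ← tsum_mul_left]
  rw [← (summable_of_tsum_tsum_enorm_ne_top hfin).tsum_comm]
  refine tsum_congr fun j => ?_
  rw [Finset.sum_mul, tsum_eq_sum (s := Finset.range (j + 1)) fun m hm => ?_]
  · exact Finset.sum_congr rfl fun m _ => by ring
  · rw [hausCoef_of_lt b 0 (by simpa [Nat.lt_succ_iff] using hm)]
    ring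

theorem dualCesaro_comm {p : ℝ≥0∞} (hp : 1 ≤ p) (hp' : p ≠ ∞) {a b : ℂ} (ha : 0 < a.re)
    (hb : 0 < b.re) {h : ℕ → ℂ} (hh : Memℓp h p) :
    dualCesaro a (dualCesaro b h) = dualCesaro b (dualCesaro a h) := by
  funext n
  rw [dualCesaro_dualCesaro hp hp' ha hb hh, dualCesaro_dualCesaro hp hp' hb ha hh]
  simp_rw [sum_hausCoef_mul_hausCoef_comm ha hb]

theorem summable_dualCesaroTerm {p : ℝ≥0∞} (hp : 1 ≤ p) (hp' : p ≠ ∞) {β : ℂ} (hβ : 0 < β.re)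
    {h : ℕ → ℂ} (hh : Memℓp h p) (n : ℕ) : Summable (dualCesaroTerm β h n) := by
  obtain ⟨C, hC, hCn⟩ := exists_tsum_enorm_hausCoef_mul_le hp hp' hβ hh
  have hs := summable_of_tsum_enorm_ne_top (ne_top_of_le_ne_top hC (hCn n))
  exact (hs.comp_injective (add_right_injective n)).congr fun j => (dualCesaroTerm_eq hβ h n j).symm

namespace Tau

variable {α : ℝ} {p : ℝ≥0∞}

theorem tendsto_seq (hα : 0 < α) (f : Tau α p) : Tendsto f.seq atTop (𝓝 0) := f.2.1 hα

theorem memℓp_weightedDiff (f : Tau α p) : Memℓp (weightedDiff α f.seq) p := f.2.2.2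

/-- For `α > 0` this is the inversion formula together with boundedness of `C_α^*` on `ℓ^p`; it
brings the `ℓ^p` results to bear on `f` itself. -/
theorem memℓp_seq (hα : 0 ≤ α) (hp : 1 ≤ p) (hp' : p ≠ ∞) (f : Tau α p) : Memℓp f.seq p := by
  rcases hα.eq_or_lt with rfl | h
  · simpa only [weightedDiff_zero] using f.memℓp_weightedDiff
  · rw [eq_dualCesaro_weightedDiff hp hp' h (f.tendsto_seq h) f.memℓp_weightedDiff]
    exact Memℓp.dualCesaro hp hp' (by exact_mod_cast h) f.memℓp_weightedDiff

/-- For `α > 0` write `f = C_α^* h` with `h = D^α f`: then `C_β^* f = C_α^* C_β^* h`, and `D^α`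
cancels `C_α^*`. -/
theorem weightedDiff_dualCesaro (hα : 0 ≤ α) (hp : 1 ≤ p) (hp' : p ≠ ∞) {β : ℂ} (hβ : 0 < β.re)
    (f : Tau α p) :
    weightedDiff α (dualCesaro β f.seq) = dualCesaro β (weightedDiff α f.seq) := by
  rcases hα.eq_or_lt with rfl | h
  · rw [weightedDiff_zero, weightedDiff_zero]
  · have h' : 0 < (α : ℂ).re := h
    have hf := f.memℓp_weightedDiff
    conv_lhs => rw [eq_dualCesaro_weightedDiff hp hp' h (f.tendsto_seq h) hf,
      dualCesaro_comm hp hp' hβ h' hf]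
    exact weightedDiff_dualCesaro_self hp hp' h (Memℓp.dualCesaro hp hp' hβ hf)

end Tau

theorem exists_dualCesaro_operator {α : ℝ} (hα : 0 ≤ α) {β : ℂ} (hβ : 0 < β.re) {p : ℝ≥0∞}
    [Fact (1 ≤ p)] (hp' : p ≠ ∞) :
    ∃ L : Tau α p →L[ℂ] Tau α p, (∀ f : Tau α p, (L f).seq = dualCesaro β f.seq) ∧
      ‖L‖ ≤ ‖β‖ * (Real.Gamma β.re * Real.Gamma (invExp p) / Real.Gamma (β.re + invExp p)) := by
  have hp : 1 ≤ p := Fact.out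
  have h1 := invExp_pos hp hp'
  have hs := fun f : Tau α p => summable_dualCesaroTerm hp hp' hβ (f.memℓp_seq hα hp hp')
  refine Tau.exists_continuousLinearMap (dualCesaro β) (fun f g => ?_) (fun c f => ?_) (fun f => ?_)
    (by positivity) fun f => ?_
  · funext n
    have : (f + g).seq = f.seq + g.seq := rfl
    rw [Pi.add_apply, dualCesaro, dualCesaro, dualCesaro, ← (hs f n).tsum_add (hs g n)]
    simp only [dualCesaroTerm, this, Pi.add_apply, mul_add]
  · funext n
    have : (c • f).seq = c • f.seq := rfl
    rw [Pi.smul_apply, smul_eq_mul, dualCesaro, dualCesaro, ← tsum_mul_left]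
    simp only [dualCesaroTerm, this, Pi.smul_apply, smul_eq_mul, mul_left_comm _ c]
  · have h0 := tendsto_zero_of_memℓp hp hp' (Memℓp.dualCesaro hp hp' hβ (f.memℓp_seq hα hp hp'))
    obtain ⟨C, hC⟩ := exists_norm_le_of_tendsto h0
    exact ⟨fun _ => h0, summable_weylDiff hα hC⟩
  · rw [f.weightedDiff_dualCesaro hα hp hp' hβ]
    exact memℓp_dualCesaro_and_norm_le hp hp' hβ (Tau.toLp α p f)

/-! ### Subordination integrals -/

theorem image_exp_neg_Ioi : (fun t : ℝ => Real.exp (-t)) '' Set.Ioi 0 = Set.Ioo 0 1 := by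
  ext r
  constructor
  · rintro ⟨t, ht, rfl⟩
    exact ⟨Real.exp_pos _, Real.exp_lt_one_iff.2 (neg_lt_zero.2 ht)⟩
  · rintro ⟨h0, h1⟩
    exact ⟨-Real.log r, neg_pos.2 (Real.log_neg h0 h1), by simp [Real.exp_log h0]⟩

theorem hasDerivWithinAt_exp_neg (t : ℝ) (s : Set ℝ) :
    HasDerivWithinAt (fun t : ℝ => Real.exp (-t)) (-Real.exp (-t)) s t := by
  simpa using ((hasDerivAt_id t).neg.exp).hasDerivWithinAt

theorem injOn_exp_neg (s : Set ℝ) : Set.InjOn (fun t : ℝ => Real.exp (-t)) s := fun _ _ _ _ h =>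
  neg_injective (Real.exp_injective h)

theorem integrableOn_Ioo_iff_exp_neg (g : ℝ → ℂ) : IntegrableOn g (Set.Ioo 0 1) ↔
    IntegrableOn (fun t => (Real.exp (-t) : ℂ) * g (Real.exp (-t))) (Set.Ioi 0) := by
  rw [← image_exp_neg_Ioi, integrableOn_image_iff_integrableOn_abs_deriv_smul measurableSet_Ioi
    (fun t _ => hasDerivWithinAt_exp_neg t _) (injOn_exp_neg _)]
  simp

theorem integral_Ioo_eq_exp_neg (g : ℝ → ℂ) : ∫ r in Set.Ioo (0 : ℝ) 1, g r =
    ∫ t in Set.Ioi (0 : ℝ), (Real.exp (-t) : ℂ) * g (Real.exp (-t)) := by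
  rw [← image_exp_neg_Ioi, integral_image_eq_integral_abs_deriv_smul measurableSet_Ioi
    (fun t _ => hasDerivWithinAt_exp_neg t _) (injOn_exp_neg _)]
  simp

theorem subordKernel_mul_semigroupT (β : ℂ) (p : ℝ≥0∞) (t : ℝ) (f : ℕ → ℂ) (n : ℕ) :
    subordKernel β (1 - invExp p) t * semigroupT p t f n =
      (Real.exp (-t) : ℂ) * (betaWeight β (Real.exp (-t)) * binAvg (Real.exp (-t)) f n) := by
  have h1 : ∑ j ∈ Finset.range (n + 1),
      ((n.choose j * Real.exp (-t * j) * (1 - Real.exp (-t)) ^ (n - j) : ℝ) : ℂ) * f j =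
      binAvg (Real.exp (-t)) f n := by
    refine Finset.sum_congr rfl fun j hj => ?_
    obtain ⟨m, rfl⟩ := Nat.exists_eq_add_of_le (Nat.lt_succ_iff.1 (Finset.mem_range.1 hj))
    rw [binKernel_zero_add, Nat.add_sub_cancel_left, ← Real.exp_nat_mul, mul_comm (-t)]
  have h2 : Real.exp (-t * (1 - invExp p)) * Real.exp (-t * invExp p) = Real.exp (-t) := by
    rw [← Real.exp_add]
    ring_nf
  rw [subordKernel, semigroupT, h1, betaWeight, ← h2]
  push_cast
  ring

/-- The transposed binomial average `∑_{j ≥ n} (j choose n) r^n (1 - r)^{j-n} f(j)`. -/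
def dualBinAvg (r : ℝ) (f : ℕ → ℂ) (n : ℕ) : ℂ :=
  ∑' j, (binKernel 0 (n + j) n r : ℂ) * f (n + j)

/-- The exponents `1/p` and `1 - 1/p + n` add up to `1 + n`: one factor `e^{-t}` is the Jacobian of
`r = e^{-t}`, the others are the `r^n` of the kernel. -/
theorem subordKernel_mul_semigroupS (β : ℂ) (p : ℝ≥0∞) (t : ℝ) (f : ℕ → ℂ) (n : ℕ) :
    subordKernel β (invExp p) t * semigroupS p t f n =
      (Real.exp (-t) : ℂ) * (betaWeight β (Real.exp (-t)) * dualBinAvg (Real.exp (-t)) f n) := by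
  have h1 : dualBinAvg (Real.exp (-t)) f n =
      (Real.exp (-t) ^ n : ℝ) * ∑' j, semigroupSTerm t f n j := by
    rw [dualBinAvg, ← tsum_mul_left]
    refine tsum_congr fun j => ?_
    rw [semigroupSTerm, binKernel_zero_add]
    push_cast
    ring
  have h2 : Real.exp (-t * invExp p) * Real.exp (-t * (1 - invExp p + n)) =
      Real.exp (-t) * Real.exp (-t) ^ n := by
    rw [← Real.exp_add, ← Real.exp_nat_mul, ← Real.exp_add]
    ring_nf
  have h3 := congrArg (fun x : ℝ => (x : ℂ)) h2
  simp only [Complex.ofReal_mul] at h3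
  rw [subordKernel, semigroupS, h1, betaWeight]
  linear_combination ((1 - Real.exp (-t) : ℝ) : ℂ) ^ (β - 1) *
    (∑' j, semigroupSTerm t f n j) * h3

theorem summable_semigroupSTerm {f : ℕ → ℂ} {C : ℝ} (hf : ∀ n, ‖f n‖ ≤ C) (n : ℕ) {t : ℝ}
    (ht : 0 ≤ t) : Summable (semigroupSTerm t f n) := by
  have h0 : 0 ≤ 1 - Real.exp (-t) := sub_nonneg.2 (Real.exp_le_one_iff.2 (neg_nonpos.2 ht))
  have hs := summable_choose_mul_geometric_of_norm_lt_one n (r := 1 - Real.exp (-t)) (by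
    rw [Real.norm_of_nonneg h0]
    linarith [Real.exp_pos (-t)])
  refine Summable.of_norm_bounded (hs.mul_right C) fun j => ?_
  rw [semigroupSTerm, norm_mul, Complex.norm_real, Real.norm_of_nonneg (by positivity),
    add_comm n j]
  exact mul_le_mul_of_nonneg_left (hf _) (by positivity)

theorem hasSum_dualBinAvg {f : ℕ → ℂ} {C : ℝ} (hf : ∀ n, ‖f n‖ ≤ C) (n : ℕ) {r : ℝ}
    (hr : r ∈ Set.Ioo (0 : ℝ) 1) :
    HasSum (fun j => (binKernel 0 (n + j) n r : ℂ) * f (n + j)) (dualBinAvg r f n) := by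
  refine Summable.hasSum (Summable.of_norm_bounded
    ((hasSum_binKernel_column 0 n hr).summable.mul_right C) fun j => ?_)
  have h0 := binKernel_nonneg le_rfl (n + j) n hr.1.le hr.2.le
  rw [norm_mul, Complex.norm_real, Real.norm_of_nonneg h0]
  exact mul_le_mul_of_nonneg_left (hf _) h0

/-- `G` is not assumed measurable; on `s` it is a pointwise limit of measurable partial sums. -/
theorem integrableOn_tsum_and_integral_eq {F : ℕ → ℝ → ℂ} {G : ℝ → ℂ} {s : Set ℝ}
    (hs : MeasurableSet s) (hF : ∀ j, Measurable (F j))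
    (hG : ∀ r ∈ s, HasSum (fun j => F j r) (G r))
    (hfin : ∑' j, ∫⁻ r in s, ‖F j r‖ₑ ≠ ∞) :
    IntegrableOn G s ∧ ∫ r in s, G r = ∑' j, ∫ r in s, F j r := by
  refine ⟨⟨?_, ?_⟩, ?_⟩
  · refine aestronglyMeasurable_of_tendsto_ae atTop
      (f := fun N r => ∑ j ∈ Finset.range N, F j r)
      (fun N => (Finset.measurable_fun_sum _ fun j _ => hF j).aestronglyMeasurable) ?_
    exact (ae_restrict_iff' hs).2 (.of_forall fun r hr => (hG r hr).tendsto_sum_nat)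
  · rw [hasFiniteIntegral_iff_enorm]
    refine lt_of_le_of_lt ?_ hfin.lt_top
    rw [← lintegral_tsum fun j => (hF j).enorm.aemeasurable]
    refine setLIntegral_mono' hs fun r hr => ?_
    rw [← (hG r hr).tsum_eq]
    exact enorm_tsum_le_tsum_enorm
  · rw [← integral_tsum (fun j => (hF j).aestronglyMeasurable) hfin]
    exact setIntegral_congr_fun hs fun r hr => (hG r hr).tsum_eq.symm

theorem integrableOn_and_dualCesaro_eq_integral {p : ℝ≥0∞} (hp : 1 ≤ p) (hp' : p ≠ ∞) {β : ℂ}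
    (hβ : 0 < β.re) {f : ℕ → ℂ} (hf : Memℓp f p) (n : ℕ) :
    IntegrableOn (fun r => betaWeight β r * dualBinAvg r f n) (Set.Ioo (0 : ℝ) 1) ∧
      dualCesaro β f n = β * ∫ r in Set.Ioo (0 : ℝ) 1, betaWeight β r * dualBinAvg r f n := by
  obtain ⟨C, hC⟩ := exists_norm_le_of_tendsto (tendsto_zero_of_memℓp hp hp' hf)
  have hfin : ∑' j, ∫⁻ r in Set.Ioo (0 : ℝ) 1,
      ‖betaWeight β r * (binKernel 0 (n + j) n r : ℂ) * f (n + j)‖ₑ ≠ ∞ := by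
    have h1 : ∑' j, betaAvg 0 β.re 1 j n * ‖f j‖ₑ ≠ ∞ := ne_top_of_le_ne_top
      (ENNReal.mul_ne_top ENNReal.ofReal_ne_top (seqNorm_ne_top hp hf))
      ((le_seqNorm hp (fun n => ∑' j, betaAvg 0 β.re 1 j n * ‖f j‖ₑ) n).trans
        (seqNorm_betaAvg_transpose_le hp hp' hβ _))
    refine ne_top_of_le_ne_top h1 (le_trans (le_of_eq ?_)
      (ENNReal.tsum_comp_le_tsum_of_injective (add_right_injective n) _))
    refine tsum_congr fun j => ?_
    simp_rw [enorm_mul _ (f (n + j))]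
    rw [lintegral_mul_const _ (by fun_prop), lintegral_enorm_betaWeight_mul_binKernel le_rfl]
  obtain ⟨h1, h2⟩ := integrableOn_tsum_and_integral_eq measurableSet_Ioo
    (G := fun r => betaWeight β r * dualBinAvg r f n) (fun j => by fun_prop) (fun r hr => by
      simpa only [mul_assoc] using (hasSum_dualBinAvg hC n hr).mul_left (betaWeight β r)) hfin
  refine ⟨h1, ?_⟩
  rw [h2, ← tsum_mul_left]
  refine tsum_congr fun j => ?_
  rw [dualCesaroTerm_eq hβ, integral_mul_const, hausCoef, mul_assoc]

end CesaroTau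

end

/-! ### The theorem for both operators -/

theorem mainTheorem2 (α : ℝ) (hα : 0 ≤ α) (β : ℂ) (hβ : 0 < β.re) (p : ℝ≥0∞) [Fact (1 ≤ p)] :
    (1 < p →
      (∃ L : CesaroTau.Tau α p →L[ℂ] CesaroTau.Tau α p,
        (∀ f : CesaroTau.Tau α p, (L f).seq = CesaroTau.cesaro β f.seq) ∧
        ‖L‖ ≤ ‖β‖ * (Real.Gamma β.re * Real.Gamma (1 - CesaroTau.invExp p) /
          Real.Gamma (β.re + 1 - CesaroTau.invExp p))) ∧
      ∀ (f : CesaroTau.Tau α p) (n : ℕ),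
        IntegrableOn (fun t : ℝ => CesaroTau.subordKernel β (1 - CesaroTau.invExp p) t *
          CesaroTau.semigroupT p t f.seq n) (Set.Ioi 0) ∧
        CesaroTau.cesaro β f.seq n =
          β * ∫ t in Set.Ioi (0 : ℝ), CesaroTau.subordKernel β (1 - CesaroTau.invExp p) t *
            CesaroTau.semigroupT p t f.seq n) ∧
    (p ≠ ∞ →
      (∃ L : CesaroTau.Tau α p →L[ℂ] CesaroTau.Tau α p,
        (∀ f : CesaroTau.Tau α p, (L f).seq = CesaroTau.dualCesaro β f.seq) ∧
        ‖L‖ ≤ ‖β‖ * (Real.Gamma β.re * Real.Gamma (CesaroTau.invExp p) /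
          Real.Gamma (β.re + CesaroTau.invExp p))) ∧
      ∀ (f : CesaroTau.Tau α p) (n : ℕ),
        Summable (CesaroTau.dualCesaroTerm β f.seq n) ∧
        (∀ t : ℝ, 0 ≤ t → Summable (CesaroTau.semigroupSTerm t f.seq n)) ∧
        IntegrableOn (fun t : ℝ => CesaroTau.subordKernel β (CesaroTau.invExp p) t *
          CesaroTau.semigroupS p t f.seq n) (Set.Ioi 0) ∧
        CesaroTau.dualCesaro β f.seq n =
          β * ∫ t in Set.Ioi (0 : ℝ), CesaroTau.subordKernel β (CesaroTau.invExp p) t *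
            CesaroTau.semigroupS p t f.seq n) := by
  open CesaroTau in
  refine ⟨fun hp => ⟨?_, fun f n => ⟨?_, ?_⟩⟩, fun hp' => ⟨?_, fun f n => ?_⟩⟩
  · rw [add_sub_assoc]
    exact exists_cesaro_operator hα hβ hp
  · simp_rw [subordKernel_mul_semigroupT]
    exact (integrableOn_Ioo_iff_exp_neg _).1 (integrableOn_betaWeight_mul_binAvg hβ f.seq n)
  · simp_rw [subordKernel_mul_semigroupT]
    rw [cesaro_eq_integral hβ, integral_Ioo_eq_exp_neg]
  · exact exists_dualCesaro_operator hα hβ hp'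
  · have hp : 1 ≤ p := Fact.out
    have hf := f.memℓp_seq hα hp hp'
    obtain ⟨C, hC⟩ := f.exists_norm_seq_le hα hp
    obtain ⟨h1, h2⟩ := integrableOn_and_dualCesaro_eq_integral hp hp' hβ hf n
    refine ⟨summable_dualCesaroTerm hp hp' hβ hf n,
      fun t ht => summable_semigroupSTerm hC n ht, ?_, ?_⟩
    · simp_rw [subordKernel_mul_semigroupS]
      exact (integrableOn_Ioo_iff_exp_neg _).1 h1
    · simp_rw [subordKernel_mul_semigroupS]
      rw [h2, integral_Ioo_eq_exp_neg]
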